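/- Let $d\ge 2$ and $1\le m\le d-1$ be integers. Let $G$ be a loopless multigraph on a finite vertex set $V$ with $|V|\ge 3$, whose edge multiplicities $m_{ij}=m_{ji}$ all lie in $\{0,m\}$ (multiplicity $0$ means no edge), and suppose that $G$ is connected. On $\mathbb C^d$ with basis $(|q\rangle)_{q\in\mathbb Z/d}$ let $X=\sum_q|q+1\rangle\langle q|$ and $Z=\sum_q\omega^q|q\rangle\langle q|$ with $\omega=e^{2\pi i/d}$, and let $|G\rangle\in(\mathbb C^d)^{\otimes V}$ be the graph state of $G$: the unit vector, unique up to a phase, with $g_i|G\rangle=|G\rangle$ for all $i\in V$, where $g_i=X_i\otimes\bigotimes_{j\ne i}Z_j^{m_{ij}}$. A network with party set $V$ and bipartite sources consists of finitely many sources $e$, each assigned to a set of exactly two parties. A state $\rho$ on $(\mathbb C^d)^{\otimes V}$ can be prepared in the corresponding correlated quantum network if $$\rho=\sum_\lambda p_\lambda\Bigl(\bigotimes_{v\in V}\mathcal E_v^{(\lambda)}\Bigr)\Bigl[\bigotimes_e\varsigma_e\Bigr],$$ where each $\varsigma_e$ is a density matrix of two particles of arbitrary finite dimensions, sent to the two parties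 of $e$, $(p_\lambda)$ is a discrete probability distribution, and each $\mathcal E_v^{(\lambda)}$ is a quantum channel from all the particles received by $v$ to $\mathbb C^d$. Write $\mathcal F(|G\rangle\langle G|,\rho)=\langle G|\rho|G\rangle$, and for $t\in\mathbb N$ let $\theta_{t,d}\in[0,\pi/2]$ be the angle with $\sin\theta_{t,d}=|\cos(tm\pi/d)|$. Then: 1. $|G\rangle\langle G|$ cannot be prepared in any correlated quantum network with only bipartite sources. 2. There is $t\in\mathbb N$ with $|\cos(tm\pi/d)|\le\frac12$. For every such $t$ and every state $\rho$ that can be prepared in some correlated quantum network with only bipartite sources, $$\mathcal F(|G\rangle\langle G|,\rho)\le\frac{7+\sqrt{4+5\sin\theta_{t,d}}}{10}\le\frac{7+\sqrt{13/2}}{10}<0.95496 .$$ 3. For every such state $\rho$, moreover, $\mathcal F(|G\rangle\langle G|,\rho)<0.95495$. -/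

import Mathlib

open Matrix
open scoped ComplexOrder

/-- The tensor (Kronecker) product `⨂ v, A v` of a finite family of matrices. -/
def tensorProd {V : Type*} [Fintype V] {I O : V → Type*}
    (A : ∀ v, Matrix (O v) (I v) ℂ) : Matrix (∀ v, O v) (∀ v, I v) ℂ :=
  Matrix.of fun x y => ∏ v, A v (x v) (y v)

/-- A density matrix: positive semidefinite with trace one. -/
def IsDensity {I : Type*} [Fintype I] (ρ : Matrix I I ℂ) : Prop :=
  ρ.PosSemidef ∧ ρ.trace = 1

/-- A quantum channel (completely positive trace-preserving map) between finite-dimensional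
systems with basis labels `I` and `O`, in operator-sum (Kraus) form:
`X ↦ ∑ k, K k * X * (K k)ᴴ` with `∑ k, (K k)ᴴ * K k = 1`. -/
structure QChannel (I O : Type*) [Fintype I] [DecidableEq I] [Fintype O] where
  rank : ℕ
  kraus : Fin rank → Matrix O I ℂ
  complete : ∑ k, (kraus k)ᴴ * kraus k = 1

/-- The action `⨂ v, C v` of local channels on a joint operator. -/
def tensorChannel {V : Type*} [Fintype V] [DecidableEq V] {I O : V → Type*}
    [∀ v, Fintype (I v)] [∀ v, DecidableEq (I v)] [∀ v, Fintype (O v)]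
    (C : ∀ v, QChannel (I v) (O v)) (X : Matrix (∀ v, I v) (∀ v, I v) ℂ) :
    Matrix (∀ v, O v) (∀ v, O v) ℂ :=
  ∑ k : (∀ v, Fin (C v).rank),
    tensorProd (fun v => (C v).kraus (k v)) * X * (tensorProd (fun v => (C v).kraus (k v)))ᴴ

/-- A network with set of parties `V`: a finite hypergraph with (indexed) hyperedges, where the
source `e` dispatches particles to the parties in `parties e`. -/
structure QNetwork (V : Type*) where
  numSources : ℕ
  parties : Fin numSources → Finset V

/-- All sources are bipartite. -/
def QNetwork.IsBipartite {V : Type*} (N : QNetwork V) : Prop :=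
  ∀ e, (N.parties e).card = 2

/-- A way of operating a correlated quantum network whose parties output systems of dimension `d`.
The particle which source `e` sends to party `v` has dimension `dim e v` (arbitrary). -/
structure CQNModel {V : Type*} [Fintype V] [DecidableEq V] (N : QNetwork V) (d : ℕ) [NeZero d] where
  dim : Fin N.numSources → V → ℕ
  /-- the state emitted by each source -/
  source : ∀ e, Matrix (∀ v : {v // v ∈ N.parties e}, Fin (dim e v))
    (∀ v : {v // v ∈ N.parties e}, Fin (dim e v)) ℂ
  source_density : ∀ e, IsDensity (source e)
  /-- values of the (discrete) shared random variable -/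
  Λ : Type
  prob : Λ → ℝ
  prob_nonneg : ∀ l, 0 ≤ prob l
  prob_sum : HasSum prob 1
  /-- for each value of the shared randomness, a local channel for each party, from all the
  particles that the party receives to its output system -/
  channel : Λ → ∀ v, QChannel (∀ e : {e // v ∈ N.parties e}, Fin (dim e v)) (ZMod d)

/-- The joint state `⨂ e, source e`, with its tensor factors grouped by the receiving party. -/
def CQNModel.jointSource {V : Type*} [Fintype V] [DecidableEq V] {N : QNetwork V} {d : ℕ} [NeZero d]
    (M : CQNModel N d) :
    Matrix (∀ v, ∀ e : {e // v ∈ N.parties e}, Fin (M.dim e v))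
      (∀ v, ∀ e : {e // v ∈ N.parties e}, Fin (M.dim e v)) ℂ :=
  Matrix.of fun x y => ∏ e, M.source e (fun v => x v ⟨e, v.2⟩) (fun v => y v ⟨e, v.2⟩)

/-- `ρ` can be prepared in the correlated quantum network `N`:
`ρ = ∑ l, p l • (⨂ v, C l v) (⨂ e, ς e)` for some choice of the source states, the shared
randomness and the local channels. -/
def QNetwork.CanPrepare {V : Type*} [Fintype V] [DecidableEq V] (N : QNetwork V) {d : ℕ} [NeZero d]
    (ρ : Matrix (V → ZMod d) (V → ZMod d) ℂ) : Prop :=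
  ∃ M : CQNModel N d,
    HasSum (fun l => (M.prob l : ℂ) • tensorChannel (M.channel l) M.jointSource) ρ

/-- The shift operator `X = ∑ q, |q + 1⟩⟨q|`. -/
def shiftX (d : ℕ) [NeZero d] : Matrix (ZMod d) (ZMod d) ℂ :=
  Matrix.of fun p q => if p = q + 1 then 1 else 0

/-- The clock operator `Z = ∑ q, ω ^ q |q⟩⟨q|` with `ω = exp (2 π i / d)`. -/
noncomputable def clockZ (d : ℕ) [NeZero d] : Matrix (ZMod d) (ZMod d) ℂ :=
  Matrix.diagonal fun q => Complex.exp (2 * Real.pi * Complex.I / d) ^ q.val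

/-- A loopless multigraph: `mult i j` is the multiplicity of the edge between `i` and `j`, and
multiplicity `0` means that there is no edge. -/
structure QMultigraph (V : Type*) where
  mult : V → V → ℕ
  symm : ∀ i j, mult i j = mult j i
  loopless : ∀ i, mult i i = 0

/-- The simple graph of the edges of nonzero multiplicity. -/
def QMultigraph.support {V : Type*} (G : QMultigraph V) : SimpleGraph V where
  Adj i j := G.mult i j ≠ 0
  symm := ⟨fun i j h => by rwa [G.symm j i]⟩
  loopless := ⟨fun i h => h (G.loopless i)⟩

/-- The stabilizer `g i = X_i ⊗ ⨂ (j ≠ i), Z_j ^ mult i j`. -/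
noncomputable def QMultigraph.stabilizer {V : Type*} [Fintype V] [DecidableEq V] (G : QMultigraph V)
    (d : ℕ) [NeZero d] (i : V) : Matrix (V → ZMod d) (V → ZMod d) ℂ :=
  tensorProd fun j => if j = i then shiftX d else clockZ d ^ G.mult i j

/-- `ψ` is the (normalized) graph state vector of `G` in local dimension `d`: the common
eigenvector with eigenvalue `1` of all the stabilizers, which is unique up to a phase. -/
def QMultigraph.IsGraphState {V : Type*} [Fintype V] [DecidableEq V] (G : QMultigraph V)
    {d : ℕ} [NeZero d] (ψ : (V → ZMod d) → ℂ) : Prop :=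
  ∑ x, ‖ψ x‖ ^ 2 = 1 ∧ ∀ i, G.stabilizer d i *ᵥ ψ = ψ

/-- The projector `|ψ⟩⟨ψ|`. -/
def ketBra {I : Type*} (ψ : I → ℂ) : Matrix I I ℂ :=
  Matrix.vecMulVec ψ (star ψ)

/-- The fidelity `⟨ψ|ρ|ψ⟩` between the pure state `|ψ⟩⟨ψ|` and `ρ`. -/
def pureFidelity {I : Type*} [Fintype I] (ψ : I → ℂ) (ρ : Matrix I I ℂ) : ℝ :=
  (star ψ ⬝ᵥ (ρ *ᵥ ψ)).re

/-- The angle `θ ∈ [0, π / 2]` with `sin θ = |cos (t m π / d)|`. -/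
noncomputable def graphAngle (t m d : ℕ) : ℝ :=
  Real.arcsin |Real.cos (t * m * Real.pi / d)|

/-!
The fidelity is affine, so shared randomness plays no role and it suffices to treat a fixed network
state `ρ` with fidelity `F`, i.e. fixed local channels acting on independent bipartite sources.

Cutting (`CQNModel.exists_cut`). Let `A` and `C` be disjoint sets of parties. Replacing every source
between `A` and `C` by the product of its marginals gives a state `η` with the same expectations as
`ρ` for all product observables that are trivial on `A` or trivial on `C`, while the expectation in
`η` of an observable on `A` times an observable on `C` is the product of their expectations in `ρ`.
To see this, expand the observables, pulled back through the channels, into product operators on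
the particles; the expectation of such an operator is a product over the sources.

Let `P` and `Q` be commuting stabilizers, `P` trivial on `C` and `Q` trivial on `A`, whose product
is supported on `A ∪ C`. The projections onto the fixed spaces of `P` and `Q` have expectations at
least `F` in `η`, so `Re ⟨P Q⟩_η ≥ 4 F - 3`. This expectation factorizes, so the restriction `P_A`
of `P` to `A` satisfies `|⟨P_A⟩_ρ| ≥ 4 F - 3` (`CQNModel.four_mul_fidelity_sub_three_le`). A third
stabilizer `R` has `|⟨R⟩_ρ| ≥ 2 F - 1`. If `R` and `P_A` commute only up to a phase `ζ` with
`|1 + ζ| = 2 c`, then the uncertainty relation `IsDensity.uncertainty`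
gives `s ^ 2 ≤ s + 2 c x y` with `x = |⟨P_A⟩|`, `y = |⟨R⟩|`, `s = x ^ 2 + y ^ 2`. In particular
`(4 F - 3) ^ 2 + (2 F - 1) ^ 2 ≤ 1 + c`, which is the bound with the square root; keeping track of
`x ≠ y` gives slightly more (`FidelityConstraint.le_of_le_half`).

Suitable stabilizers exist. If the graph has an induced path `a - b - c`, take `P = g_a ^ t`,
`Q = g_c ^ (-t)` and `R = g_b`: since all multiplicities are equal, `P` and `Q` cancel on the common
neighbours of `a` and `c`. Otherwise the graph is complete and `P = g_a ^ t g_b ^ (-t)`,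
`Q = g_b ^ t g_c ^ (-t)`, `R = g_b` do, with `A = {a}` and `C = {c}`. In both cases the phase is
`ω ^ (m t)`, for which `c = |cos (t m π / d)|`.
-/

/-! ### Tensor products of matrices -/

section TensorProd

variable {V : Type*} [Fintype V] {I J K : V → Type*}

theorem tensorProd_mul [DecidableEq V] [∀ v, Fintype (J v)] (A : ∀ v, Matrix (I v) (J v) ℂ)
    (B : ∀ v, Matrix (J v) (K v) ℂ) :
    tensorProd A * tensorProd B = tensorProd fun v => A v * B v := by
  ext x y
  simp only [tensorProd, mul_apply, of_apply, ← Finset.prod_mul_distrib]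
  rw [Fintype.prod_sum fun v j => A v (x v) j * B v j (y v)]

theorem tensorProd_conjTranspose (A : ∀ v, Matrix (I v) (J v) ℂ) :
    (tensorProd A)ᴴ = tensorProd fun v => (A v)ᴴ := by
  ext x y
  simp [tensorProd, conjTranspose_apply]

theorem tensorProd_one [∀ v, DecidableEq (I v)] :
    tensorProd (fun v => (1 : Matrix (I v) (I v) ℂ)) = 1 := by
  ext x y
  simp only [tensorProd, of_apply, one_apply, Finset.prod_ite_zero, Finset.prod_const_one,
    Finset.mem_univ, true_imp_iff, funext_iff]

theorem tensorProd_smul (c : V → ℂ) (A : ∀ v, Matrix (I v) (J v) ℂ) :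
    (tensorProd fun v => c v • A v) = (∏ v, c v) • tensorProd A := by
  ext x y
  simp [tensorProd, Finset.prod_mul_distrib]

theorem tensorProd_sum [DecidableEq V] {κ : V → Type*} [∀ v, Fintype (κ v)]
    (A : ∀ v, κ v → Matrix (I v) (J v) ℂ) :
    (tensorProd fun v => ∑ k, A v k) = ∑ k : ∀ v, κ v, tensorProd fun v => A v (k v) := by
  ext x y
  simp only [tensorProd, of_apply, Matrix.sum_apply]
  rw [Fintype.prod_sum fun v k => A v k (x v) (y v)]

theorem tensorProd_pow [DecidableEq V] [∀ v, Fintype (I v)] [∀ v, DecidableEq (I v)]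
    (A : ∀ v, Matrix (I v) (I v) ℂ) (n : ℕ) :
    tensorProd A ^ n = tensorProd fun v => A v ^ n := by
  induction n with
  | zero => simp [tensorProd_one]
  | succ n ih => simp only [pow_succ, ih, tensorProd_mul]

theorem trace_tensorProd [DecidableEq V] [∀ v, Fintype (I v)] (A : ∀ v, Matrix (I v) (I v) ℂ) :
    (tensorProd A).trace = ∏ v, (A v).trace := by
  simp only [trace, diag_apply, tensorProd, of_apply]
  rw [Fintype.prod_sum fun v j => A v j j]

theorem tensorProd_update_one [DecidableEq V] [∀ v, DecidableEq (I v)] (v : V)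
    (X : Matrix (I v) (I v) ℂ) (x y : ∀ w, I w) :
    tensorProd (Function.update (fun w => (1 : Matrix (I w) (I w) ℂ)) v X) y x =
      if ∀ w, w ≠ v → x w = y w then X (y v) (x v) else 0 := by
  simp only [tensorProd, of_apply]
  rw [← Finset.mul_prod_erase _ _ (Finset.mem_univ v), Function.update_self]
  split_ifs with h
  · rw [Finset.prod_eq_one, mul_one]
    intro w hw
    rw [Function.update_of_ne (Finset.ne_of_mem_erase hw), h w (Finset.ne_of_mem_erase hw),
      one_apply_eq]
  · push Not at h
    obtain ⟨w, hw, hne⟩ := h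
    rw [Finset.prod_eq_zero (i := w), mul_zero]
    · exact Finset.mem_erase.mpr ⟨hw, Finset.mem_univ _⟩
    · rw [Function.update_of_ne hw, one_apply_ne hne.symm]

theorem tensorProd_single [∀ v, DecidableEq (I v)] (x y : ∀ w, I w) :
    tensorProd (fun w => Matrix.single (x w) (y w) (1 : ℂ)) = Matrix.single x y 1 := by
  ext a b
  simp only [tensorProd, of_apply, Matrix.single_apply, Finset.prod_ite_zero,
    Finset.prod_const_one, Finset.mem_univ, true_imp_iff, forall_and, funext_iff]

/-- A positive semidefinite matrix is a Gram matrix. -/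
theorem posSemidef_exists_gram {n : Type*} [Fintype n] [DecidableEq n] {A : Matrix n n ℂ}
    (hA : A.PosSemidef) : ∃ B : Matrix n n ℂ, A = Bᴴ * B := by
  open scoped MatrixOrder Matrix.Norms.L2Operator in
  exact CStarAlgebra.nonneg_iff_eq_star_mul_self.mp hA.nonneg

theorem posSemidef_tensorProd [DecidableEq V] [∀ v, Fintype (I v)] [∀ v, DecidableEq (I v)]
    {A : ∀ v, Matrix (I v) (I v) ℂ} (hA : ∀ v, (A v).PosSemidef) : (tensorProd A).PosSemidef := by
  choose B hB using fun v => posSemidef_exists_gram (hA v)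
  obtain rfl : A = fun v => (B v)ᴴ * B v := funext hB
  rw [← tensorProd_mul, ← tensorProd_conjTranspose]
  exact posSemidef_conjTranspose_mul_self _

/-- Interchanging the two levels of a tensor product indexed by the flags `(e, v)` of an
incidence relation. -/
theorem tensorProd_tensorProd_swap {ι : Type*} [Fintype ι] {r : ι → V → Prop}
    [∀ e, Fintype {v // r e v}] [∀ v, Fintype {e // r e v}] {D : ι → V → Type*}
    (m : ∀ v, ∀ e : {e // r e v}, Matrix (D e v) (D e v) ℂ)
    (x y : ∀ v, ∀ e : {e // r e v}, D e v) :
    tensorProd (fun v => tensorProd (m v)) x y =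
      tensorProd (fun e => tensorProd fun v : {v // r e v} => m v ⟨e, v.2⟩)
        (fun e v => x v ⟨e, v.2⟩) (fun e v => y v ⟨e, v.2⟩) := by
  simp only [tensorProd, of_apply]
  have h1 := Fintype.prod_sigma fun p : Σ v, {e // r e v} => m p.1 p.2 (x p.1 p.2) (y p.1 p.2)
  have h2 := Fintype.prod_sigma fun p : Σ e, {v // r e v} =>
    m p.2 ⟨p.1, p.2.2⟩ (x p.2 ⟨p.1, p.2.2⟩) (y p.2 ⟨p.1, p.2.2⟩)
  refine h1.symm.trans (Eq.trans ?_ h2)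
  exact Fintype.prod_equiv
    ⟨fun p => ⟨p.2.1, p.1, p.2.2⟩, fun p => ⟨p.2.1, p.1, p.2.2⟩, fun _ => rfl, fun _ => rfl⟩
    _ _ fun _ => rfl

end TensorProd

/-! ### Density matrices -/

section States

variable {n : Type*} [Fintype n]

/-- A density matrix is nonnegative on operators of the form `Yᴴ * Y`. -/
theorem IsDensity.trace_mul_nonneg {ρ : Matrix n n ℂ} (hρ : IsDensity ρ) (Y : Matrix n n ℂ) :
    0 ≤ (ρ * (Yᴴ * Y)).trace := by
  have := (hρ.1.mul_mul_conjTranspose_same Y).trace_nonneg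
  rwa [Matrix.trace_mul_comm, ← Matrix.mul_assoc, Matrix.trace_mul_comm] at this

theorem IsDensity.trace_mul_conjTranspose {ρ : Matrix n n ℂ} (hρ : IsDensity ρ)
    (X : Matrix n n ℂ) : (ρ * Xᴴ).trace = star (ρ * X).trace := by
  rw [← Matrix.trace_conjTranspose, Matrix.conjTranspose_mul, hρ.1.isHermitian.eq,
    Matrix.trace_mul_comm]

theorem IsDensity.re_trace_le {ρ : Matrix n n ℂ} (hρ : IsDensity ρ) {p q : Matrix n n ℂ}
    (hp : pᴴ = p) (hpp : p * p = p) (hq : qᴴ = q) (hqq : q * q = q) (hpq : p * q = q) :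
    (ρ * q).trace.re ≤ (ρ * p).trace.re := by
  have hqp : q * p = q := by
    have := congrArg conjTranspose hpq
    rwa [conjTranspose_mul, hp, hq] at this
  have h := (Complex.le_def.mp (hρ.trace_mul_nonneg (p - q))).1
  have hY : (p - q)ᴴ * (p - q) = p - q := by
    simp only [conjTranspose_sub, hp, hq, sub_mul, mul_sub, hpp, hqq, hpq, hqp]; abel
  rw [hY] at h
  simp [mul_sub] at h
  linarith

end States

/-! ### Channels in the Heisenberg picture -/

section Channels

/-- The Heisenberg picture of a channel: its adjoint acting on observables. -/
def QChannel.dual {I O : Type*} [Fintype I] [DecidableEq I] [Fintype O] (C : QChannel I O)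
    (S : Matrix O O ℂ) : Matrix I I ℂ :=
  ∑ k, (C.kraus k)ᴴ * S * C.kraus k

theorem QChannel.dual_one {I O : Type*} [Fintype I] [DecidableEq I] [Fintype O] [DecidableEq O]
    (C : QChannel I O) : C.dual 1 = 1 := by
  simp [QChannel.dual, C.complete]

variable {V : Type*} [Fintype V] [DecidableEq V] {I O : V → Type*}
    [∀ v, Fintype (I v)] [∀ v, DecidableEq (I v)] [∀ v, Fintype (O v)]

theorem trace_tensorChannel_mul (C : ∀ v, QChannel (I v) (O v))
    (X : Matrix (∀ v, I v) (∀ v, I v) ℂ) (S : ∀ v, Matrix (O v) (O v) ℂ) :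
    (tensorChannel C X * tensorProd S).trace =
      (X * tensorProd fun v => (C v).dual (S v)).trace := by
  simp only [tensorChannel, QChannel.dual, tensorProd_sum, Finset.sum_mul, Finset.mul_sum,
    trace_sum]
  refine Finset.sum_congr rfl fun k _ => ?_
  rw [← tensorProd_mul, ← tensorProd_mul, ← tensorProd_conjTranspose, Matrix.mul_assoc,
    Matrix.mul_assoc, Matrix.trace_mul_comm, Matrix.mul_assoc]

theorem posSemidef_tensorChannel (C : ∀ v, QChannel (I v) (O v))
    {X : Matrix (∀ v, I v) (∀ v, I v) ℂ} (hX : X.PosSemidef) :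
    (tensorChannel C X).PosSemidef :=
  posSemidef_sum _ fun _ _ => hX.mul_mul_conjTranspose_same _

end Channels

/-! ### Marginals -/

section Marginals

variable {W : Type*} [Fintype W] [DecidableEq W] {I : W → Type*} [∀ w, Fintype (I w)]
  [∀ w, DecidableEq (I w)]

/-- The marginal (reduced state) of a joint operator on its tensor factor `v`. -/
def marginal (ρ : Matrix (∀ w, I w) (∀ w, I w) ℂ) (v : W) : Matrix (I v) (I v) ℂ :=
  Matrix.of fun k l => ∑ x, ∑ y,
    if x v = k ∧ y v = l ∧ ∀ w, w ≠ v → x w = y w then ρ x y else 0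

theorem trace_marginal_mul (ρ : Matrix (∀ w, I w) (∀ w, I w) ℂ) (v : W)
    (X : Matrix (I v) (I v) ℂ) :
    (marginal ρ v * X).trace =
      (ρ * tensorProd (Function.update (fun w => (1 : Matrix (I w) (I w) ℂ)) v X)).trace := by
  simp only [trace, diag_apply, mul_apply, tensorProd_update_one]
  simp only [marginal, of_apply, Finset.sum_mul]
  rw [Finset.sum_congr rfl fun k _ => Finset.sum_comm]
  rw [Finset.sum_comm]
  refine Finset.sum_congr rfl fun x _ => ?_
  rw [Finset.sum_congr rfl fun k _ => Finset.sum_comm]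
  rw [Finset.sum_comm]
  refine Finset.sum_congr rfl fun y _ => ?_
  rw [Fintype.sum_eq_single (x v), Fintype.sum_eq_single (y v)]
  · simp
  · intro l hl
    simp [hl.symm]
  · intro k hk
    simp [hk.symm]

theorem trace_marginal (ρ : Matrix (∀ w, I w) (∀ w, I w) ℂ) (v : W) :
    (marginal ρ v).trace = ρ.trace := by
  have := trace_marginal_mul ρ v 1
  rwa [Matrix.mul_one, Function.update_eq_self_iff.mpr rfl, tensorProd_one, Matrix.mul_one] at this

theorem posSemidef_marginal {ρ : Matrix (∀ w, I w) (∀ w, I w) ℂ} (hρ : ρ.PosSemidef) (v : W) :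
    (marginal ρ v).PosSemidef := by
  refine .of_dotProduct_mulVec_nonneg ?_ fun f => ?_
  · ext k l
    simp only [marginal, conjTranspose_apply, of_apply, star_sum]
    rw [Finset.sum_comm]
    refine Finset.sum_congr rfl fun x _ => Finset.sum_congr rfl fun y _ => ?_
    rw [apply_ite star, star_zero, hρ.isHermitian.apply]
    congr 1
    simp only [eq_iff_iff]
    constructor
    · rintro ⟨h1, h2, h3⟩
      exact ⟨h2, h1, fun w hw => (h3 w hw).symm⟩
    · rintro ⟨h1, h2, h3⟩
      exact ⟨h2, h1, fun w hw => (h3 w hw).symm⟩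
  · -- the quadratic form is the expectation of the positive operator `|f⟩⟨f| ⊗ 1`
    have hY : (tensorProd (Function.update (fun w => (1 : Matrix (I w) (I w) ℂ)) v
        (vecMulVec f (star f)))).PosSemidef := by
      refine posSemidef_tensorProd fun w => ?_
      by_cases hw : w = v
      · subst hw
        rw [Function.update_self]
        exact posSemidef_vecMulVec_self_star f
      · rw [Function.update_of_ne hw]
        exact PosSemidef.one
    obtain ⟨B, hB⟩ := posSemidef_exists_gram hY
    have h := (hρ.mul_mul_conjTranspose_same B).trace_nonneg
    rw [Matrix.trace_mul_comm, ← Matrix.mul_assoc, ← hB, Matrix.trace_mul_comm,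
      ← trace_marginal_mul, mul_vecMulVec, trace_vecMulVec, dotProduct_comm] at h
    exact h

/-- On observables that are trivial away from `v`, the product of the marginals agrees with the
joint state. -/
theorem prod_trace_marginal {ρ : Matrix (∀ w, I w) (∀ w, I w) ℂ} (hρ : ρ.trace = 1) (v : W)
    (m : ∀ w, Matrix (I w) (I w) ℂ) (hm : ∀ w, w ≠ v → m w = 1) :
    ∏ w, (marginal ρ w * m w).trace = (ρ * tensorProd m).trace := by
  rw [Fintype.prod_eq_single v, trace_marginal_mul]
  · congr 3
    ext1 w
    by_cases hw : w = v
    · subst hw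
      rw [Function.update_self]
    · rw [Function.update_of_ne hw, hm w hw]
  · intro w hw
    rw [hm w hw, Matrix.mul_one, trace_marginal, hρ]

end Marginals

/-! ### Expansion into product operators -/

section Expansion

variable {W : Type*} [Fintype W] [DecidableEq W] {I : W → Type*} [∀ w, Fintype (I w)]
  [∀ w, DecidableEq (I w)]

/-- Every operator on a tensor product is a combination of product operators, and the identity is
itself one product operator. -/
theorem exists_tensorProd_expansion (M : Matrix (∀ w, I w) (∀ w, I w) ℂ) :
    ∃ (n : ℕ) (c : Fin n → ℂ) (m : Fin n → ∀ w, Matrix (I w) (I w) ℂ),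
      M = ∑ i, c i • tensorProd (m i) ∧ (M = 1 → ∀ i w, m i w = 1) := by
  by_cases hM : M = 1
  · refine ⟨1, fun _ => 1, fun _ _ => 1, ?_, fun _ _ _ => rfl⟩
    simp [hM, tensorProd_one]
  · let e := Fintype.equivFin ((∀ w, I w) × (∀ w, I w))
    refine ⟨_, fun i => M (e.symm i).1 (e.symm i).2,
      fun i w => Matrix.single ((e.symm i).1 w) ((e.symm i).2 w) 1, ?_, fun h => (hM h).elim⟩
    simp only [tensorProd_single, Matrix.smul_single, smul_eq_mul, mul_one]
    rw [e.symm.sum_comp fun p => Matrix.single p.1 p.2 (M p.1 p.2), Fintype.sum_prod_type]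
    exact Matrix.matrix_eq_sum_single M

end Expansion

/-! ### The joint state of the sources -/

section Networks

variable {V : Type*} [DecidableEq V]

/-- The joint state of a family of sources, with its tensor factors grouped by the receiving
party. -/
def QNetwork.joint (N : QNetwork V) {D : Fin N.numSources → V → ℕ}
    (ς : ∀ e, Matrix (∀ v : {v // v ∈ N.parties e}, Fin (D e v))
      (∀ v : {v // v ∈ N.parties e}, Fin (D e v)) ℂ) :
    Matrix (∀ v, ∀ e : {e // v ∈ N.parties e}, Fin (D e v))
      (∀ v, ∀ e : {e // v ∈ N.parties e}, Fin (D e v)) ℂ :=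
  (tensorProd ς).submatrix (fun x e v => x v ⟨e, v.2⟩) (fun x e v => x v ⟨e, v.2⟩)

variable {N : QNetwork V} {D : Fin N.numSources → V → ℕ}
  {ς : ∀ e, Matrix (∀ v : {v // v ∈ N.parties e}, Fin (D e v))
      (∀ v : {v // v ∈ N.parties e}, Fin (D e v)) ℂ}

theorem posSemidef_joint (hς : ∀ e, (ς e).PosSemidef) : (N.joint ς).PosSemidef :=
  (posSemidef_tensorProd hς).submatrix _

/-- The expectation of a product operator in the joint state factors over the sources. -/
theorem trace_joint_mul_tensorProd [Fintype V]
    (m : ∀ v, ∀ e : {e // v ∈ N.parties e}, Matrix (Fin (D e v)) (Fin (D e v)) ℂ) :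
    (N.joint ς * tensorProd fun v => tensorProd (m v)).trace =
      ∏ e, (ς e * tensorProd fun v : {v // v ∈ N.parties e} => m v ⟨e, v.2⟩).trace := by
  rw [← trace_tensorProd, ← tensorProd_mul]
  -- regrouping the flags by source instead of by party
  let φ : (∀ v, ∀ e : {e // v ∈ N.parties e}, Fin (D e v)) ≃
      (∀ e, ∀ v : {v // v ∈ N.parties e}, Fin (D e v)) :=
    ⟨fun x e v => x v ⟨e, v.2⟩, fun x v e => x e ⟨v, e.2⟩, fun _ => rfl, fun _ => rfl⟩
  simp only [trace, diag_apply, mul_apply]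
  refine Fintype.sum_equiv φ _ _ fun x => Fintype.sum_equiv φ _ _ fun y => ?_
  congr 1
  exact tensorProd_tensorProd_swap
    (r := fun e v => v ∈ N.parties e) (D := fun e v => Fin (D e v)) m y x

/-- The expectation of a product of expanded local operators is a combination of products over the
sources. -/
theorem trace_joint_mul_sum [Fintype V] {κ : V → Type*} [∀ v, Fintype (κ v)] (c : ∀ v, κ v → ℂ)
    (m : ∀ v, κ v → ∀ e : {e // v ∈ N.parties e}, Matrix (Fin (D e v)) (Fin (D e v)) ℂ) :
    (N.joint ς * tensorProd fun v => ∑ i, c v i • tensorProd (m v i)).trace =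
      ∑ i : ∀ v, κ v, (∏ v, c v (i v)) *
        ∏ e, (ς e * tensorProd fun v : {v // v ∈ N.parties e} => m v (i v) ⟨e, v.2⟩).trace := by
  simp only [tensorProd_sum, tensorProd_smul, Finset.mul_sum, trace_sum, Matrix.mul_smul,
    trace_smul, smul_eq_mul]
  refine Finset.sum_congr rfl fun i _ => ?_
  rw [trace_joint_mul_tensorProd fun v => m v (i v)]

end Networks

/-! ### Cutting sources -/

section Cut

variable {V : Type*} [DecidableEq V] {N : QNetwork V} {D : Fin N.numSources → V → ℕ}

/-- The sources after cutting all the connections between `A` and `C`: a source shared by a party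
of `A` and a party of `C` is replaced by the product of its marginals. -/
def cutSource (A C : Finset V) (ς : ∀ e, Matrix (∀ v : {v // v ∈ N.parties e}, Fin (D e v))
      (∀ v : {v // v ∈ N.parties e}, Fin (D e v)) ℂ) (e : Fin N.numSources) :
    Matrix (∀ v : {v // v ∈ N.parties e}, Fin (D e v))
      (∀ v : {v // v ∈ N.parties e}, Fin (D e v)) ℂ :=
  if (∃ v ∈ N.parties e, v ∈ A) ∧ ∃ v ∈ N.parties e, v ∈ C then tensorProd (marginal (ς e))
  else ς e

variable {A C : Finset V} {ς : ∀ e, Matrix (∀ v : {v // v ∈ N.parties e}, Fin (D e v))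
      (∀ v : {v // v ∈ N.parties e}, Fin (D e v)) ℂ}

theorem cutSource_comm (A C : Finset V) (ς : ∀ e, Matrix
    (∀ v : {v // v ∈ N.parties e}, Fin (D e v)) (∀ v : {v // v ∈ N.parties e}, Fin (D e v)) ℂ) :
    cutSource A C ς = cutSource C A ς := by
  ext1 e
  simp only [cutSource, and_comm]

theorem isDensity_cutSource (hς : ∀ e, IsDensity (ς e)) (e : Fin N.numSources) :
    IsDensity (cutSource A C ς e) := by
  unfold cutSource
  split_ifs
  · refine ⟨posSemidef_tensorProd fun v => posSemidef_marginal (hς e).1 v, ?_⟩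
    rw [trace_tensorProd]
    exact Finset.prod_eq_one fun v _ => (trace_marginal _ _).trans (hς e).2
  · exact hς e

/-- A bipartite source meeting the disjoint sets `A` and `C` has all its parties in `A` or `C`. -/
theorem QNetwork.IsBipartite.eq_or_eq (hN : N.IsBipartite) {e : Fin N.numSources} {a c v : V}
    (ha : a ∈ N.parties e) (hc : c ∈ N.parties e) (hac : a ≠ c) (hv : v ∈ N.parties e) :
    v = a ∨ v = c := by
  have h : ({a, c} : Finset V) = N.parties e :=
    Finset.eq_of_subset_of_card_le (by simp [Finset.insert_subset_iff, ha, hc])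
      (by rw [hN e, Finset.card_pair hac])
  simpa [← h] using hv

/-- Cutting is invisible to observables that are trivial on `C`. -/
theorem trace_cutSource_mul (hN : N.IsBipartite) (hς : ∀ e, IsDensity (ς e)) (hAC : Disjoint A C)
    (e : Fin N.numSources)
    (m : ∀ v : {v // v ∈ N.parties e}, Matrix (Fin (D e v)) (Fin (D e v)) ℂ)
    (hm : ∀ v, v.1 ∈ C → m v = 1) :
    (cutSource A C ς e * tensorProd m).trace = (ς e * tensorProd m).trace := by
  unfold cutSource
  split_ifs with h
  · obtain ⟨⟨a, hae, ha⟩, c, hce, hc⟩ := h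
    have hac : a ≠ c := fun hh => Finset.disjoint_left.mp hAC ha (hh ▸ hc)
    rw [tensorProd_mul, trace_tensorProd, prod_trace_marginal (hς e).2 ⟨a, hae⟩]
    intro w hw
    refine hm w ?_
    rcases hN.eq_or_eq hae hce hac w.2 with h | h
    · exact (hw (Subtype.ext h)).elim
    · exact h ▸ hc
  · rfl

/-- After cutting, observables on `A` and on `C` are uncorrelated. -/
theorem trace_cutSource_mul_mul (hN : N.IsBipartite) (hς : ∀ e, IsDensity (ς e))
    (hAC : Disjoint A C) (e : Fin N.numSources)
    (m m' : ∀ v : {v // v ∈ N.parties e}, Matrix (Fin (D e v)) (Fin (D e v)) ℂ)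
    (hm : ∀ v, v.1 ∉ A → m v = 1) (hm' : ∀ v, v.1 ∉ C → m' v = 1) :
    (cutSource A C ς e * tensorProd fun v => m v * m' v).trace =
      (ς e * tensorProd m).trace * (ς e * tensorProd m').trace := by
  have hdisj : ∀ v, v ∈ A → v ∉ C := fun v hv => Finset.disjoint_left.mp hAC hv
  unfold cutSource
  split_ifs with h
  · obtain ⟨⟨a, hae, ha⟩, c, hce, hc⟩ := h
    have hac : a ≠ c := fun hh => hdisj a ha (hh ▸ hc)
    have hor : ∀ w : {v // v ∈ N.parties e}, w = ⟨a, hae⟩ ∨ w = ⟨c, hce⟩ := fun w =>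
      (hN.eq_or_eq hae hce hac w.2).imp (fun h => Subtype.ext h) fun h => Subtype.ext h
    rw [tensorProd_mul, trace_tensorProd, ← prod_trace_marginal (hς e).2 ⟨a, hae⟩ m,
      ← prod_trace_marginal (hς e).2 ⟨c, hce⟩ m', ← Finset.prod_mul_distrib]
    · refine Finset.prod_congr rfl fun w _ => ?_
      rcases hor w with rfl | rfl
      · rw [hm' _ (hdisj a ha), Matrix.mul_one, Matrix.mul_one, trace_marginal, (hς e).2, mul_one]
      · rw [hm _ fun h => hdisj c h hc, Matrix.one_mul, Matrix.mul_one, trace_marginal, (hς e).2,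
          one_mul]
    · exact fun w hw => hm' w fun h =>
        (hor w).elim (fun h' => hdisj a ha (by simpa [h'] using h)) hw
    · exact fun w hw => hm w fun h => (hor w).elim hw fun h' => hdisj c (by simpa [h'] using h) hc
  · rw [not_and_or] at h
    rcases h with h | h
    · obtain rfl : m = fun _ => 1 := funext fun v => hm v fun hv => h ⟨v, v.2, hv⟩
      simp only [tensorProd_one, Matrix.mul_one, (hς e).2, one_mul]
    · obtain rfl : m' = fun _ => 1 := funext fun v => hm' v fun hv => h ⟨v, v.2, hv⟩
      simp only [tensorProd_one, (hς e).2, mul_one]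

/-- Cutting the sources does not change the expectations of product observables trivial on `C`.
The expansion of an identity factor consists of identities, which the marginals do not see. -/
theorem trace_joint_cutSource_mul [Fintype V] (hN : N.IsBipartite)
    (hς : ∀ e, IsDensity (ς e)) (hAC : Disjoint A C)
    (M : ∀ v, Matrix (∀ e : {e // v ∈ N.parties e}, Fin (D e v))
      (∀ e : {e // v ∈ N.parties e}, Fin (D e v)) ℂ) (hM : ∀ v ∈ C, M v = 1) :
    (N.joint (cutSource A C ς) * tensorProd M).trace = (N.joint ς * tensorProd M).trace := by
  choose n c m hMm hm using fun v => exists_tensorProd_expansion (M v)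
  rw [show M = _ from funext hMm, trace_joint_mul_sum, trace_joint_mul_sum]
  refine Finset.sum_congr rfl fun i _ => congrArg _ (Finset.prod_congr rfl fun e _ => ?_)
  exact trace_cutSource_mul hN hς hAC e _ fun v hv => hm v (hM v hv) _ _

/-- After cutting, product observables on `A` and on `C` are uncorrelated: the product of their
expansions is a double sum, in which every term factorizes. -/
theorem trace_joint_cutSource_mul_mul [Fintype V] (hN : N.IsBipartite)
    (hς : ∀ e, IsDensity (ς e)) (hAC : Disjoint A C)
    (M M' : ∀ v, Matrix (∀ e : {e // v ∈ N.parties e}, Fin (D e v))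
      (∀ e : {e // v ∈ N.parties e}, Fin (D e v)) ℂ)
    (hM : ∀ v, v ∉ A → M v = 1) (hM' : ∀ v, v ∉ C → M' v = 1) :
    (N.joint (cutSource A C ς) * tensorProd fun v => M v * M' v).trace =
      (N.joint ς * tensorProd M).trace * (N.joint ς * tensorProd M').trace := by
  choose n c m hMm hm using fun v => exists_tensorProd_expansion (M v)
  choose n' c' m' hMm' hm' using fun v => exists_tensorProd_expansion (M' v)
  have hMM : (fun v => M v * M' v) = fun v => ∑ p : Fin (n v) × Fin (n' v),
      (c v p.1 * c' v p.2) • tensorProd fun e => m v p.1 e * m' v p.2 e := by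
    ext1 v
    conv_lhs => rw [hMm v, hMm' v]
    rw [Finset.sum_mul_sum, Fintype.sum_prod_type]
    simp only [Matrix.smul_mul, Matrix.mul_smul, smul_smul, tensorProd_mul, mul_comm (c' v _)]
  rw [hMM, trace_joint_mul_sum (fun v p => c v p.1 * c' v p.2)
    (fun v (p : Fin (n v) × Fin (n' v)) e => m v p.1 e * m' v p.2 e)]
  rw [show M = _ from funext hMm, show M' = _ from funext hMm', trace_joint_mul_sum,
    trace_joint_mul_sum, Finset.sum_mul_sum, ← Fintype.sum_prod_type']
  refine Fintype.sum_equiv (Equiv.arrowProdEquivProdArrow V _ _) _ _ fun p => ?_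
  rw [Finset.prod_mul_distrib]
  have : ∀ e, _ := fun e => trace_cutSource_mul_mul hN hς hAC e
    (fun v => m v (p v).1 ⟨e, v.2⟩) (fun v => m' v (p v).2 ⟨e, v.2⟩)
    (fun v hv => hm v (hM v hv) _ _) (fun v hv => hm' v (hM' v hv) _ _)
  rw [Finset.prod_congr rfl fun e _ => this e, Finset.prod_mul_distrib]
  exact mul_mul_mul_comm _ _ _ _

end Cut

/-! ### Network states and their cut inflation -/

section Model

variable {V : Type*} [Fintype V] [DecidableEq V] {N : QNetwork V} {d : ℕ} [NeZero d]

/-- The state prepared by the model for the value `l` of the shared randomness. -/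
def CQNModel.state (M : CQNModel N d) (l : M.Λ) : Matrix (V → ZMod d) (V → ZMod d) ℂ :=
  tensorChannel (M.channel l) M.jointSource

theorem isDensity_tensorChannel_joint {D : Fin N.numSources → V → ℕ}
    {ς : ∀ e, Matrix (∀ v : {v // v ∈ N.parties e}, Fin (D e v))
      (∀ v : {v // v ∈ N.parties e}, Fin (D e v)) ℂ} (hς : ∀ e, IsDensity (ς e))
    (K : ∀ v, QChannel (∀ e : {e // v ∈ N.parties e}, Fin (D e v)) (ZMod d)) :
    IsDensity (tensorChannel K (N.joint ς)) := by
  refine ⟨posSemidef_tensorChannel _ (posSemidef_joint fun e => (hς e).1), ?_⟩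
  have h := trace_tensorChannel_mul K (N.joint ς) fun _ => 1
  have h' := trace_joint_mul_tensorProd (ς := ς) fun v e => 1
  simp only [QChannel.dual_one, tensorProd_one, Matrix.mul_one] at h h'
  rw [h, h', Finset.prod_eq_one fun e _ => (hς e).2]

theorem CQNModel.isDensity_state (M : CQNModel N d) (l : M.Λ) : IsDensity (M.state l) :=
  isDensity_tensorChannel_joint M.source_density _

/-- The cut inflation of a network state: the connections between the disjoint sets `A` and `C` of
parties can be removed without changing the marginal on the complement of either set, and then `A`
and `C` are uncorrelated. -/
theorem CQNModel.exists_cut (M : CQNModel N d) (l : M.Λ) (hN : N.IsBipartite) {A C : Finset V}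
    (hAC : Disjoint A C) :
    ∃ η : Matrix (V → ZMod d) (V → ZMod d) ℂ, IsDensity η ∧
      (∀ S : V → Matrix (ZMod d) (ZMod d) ℂ, (∀ v ∈ C, S v = 1) →
        (η * tensorProd S).trace = (M.state l * tensorProd S).trace) ∧
      (∀ S : V → Matrix (ZMod d) (ZMod d) ℂ, (∀ v ∈ A, S v = 1) →
        (η * tensorProd S).trace = (M.state l * tensorProd S).trace) ∧
      ∀ S T : V → Matrix (ZMod d) (ZMod d) ℂ, (∀ v, v ∉ A → S v = 1) → (∀ v, v ∉ C → T v = 1) →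
        (η * tensorProd fun v => S v * T v).trace =
          (M.state l * tensorProd S).trace * (M.state l * tensorProd T).trace := by
  have hstate : ∀ S : V → Matrix (ZMod d) (ZMod d) ℂ, (M.state l * tensorProd S).trace =
      (N.joint M.source * tensorProd fun v => (M.channel l v).dual (S v)).trace :=
    fun S => trace_tensorChannel_mul _ _ S
  refine ⟨tensorChannel (M.channel l) (N.joint (cutSource A C M.source)),
    isDensity_tensorChannel_joint (isDensity_cutSource M.source_density) _, ?_, ?_, ?_⟩
  · intro S hS
    rw [trace_tensorChannel_mul, hstate]
    exact trace_joint_cutSource_mul hN M.source_density hAC _ fun v hv => by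
      rw [hS v hv, QChannel.dual_one]
  · intro S hS
    rw [trace_tensorChannel_mul, hstate, cutSource_comm]
    exact trace_joint_cutSource_mul hN M.source_density hAC.symm _ fun v hv => by
      rw [hS v hv, QChannel.dual_one]
  · intro S T hS hT
    rw [trace_tensorChannel_mul, hstate, hstate, ← trace_joint_cutSource_mul_mul hN
      M.source_density hAC _ _ (fun v hv => by rw [hS v hv, QChannel.dual_one])
      fun v hv => by rw [hT v hv, QChannel.dual_one]]
    congr 3
    ext1 v
    by_cases hv : v ∈ A
    · rw [hT v (Finset.disjoint_left.mp hAC hv), Matrix.mul_one, QChannel.dual_one, Matrix.mul_one]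
    · rw [hS v hv, Matrix.one_mul, QChannel.dual_one, Matrix.one_mul]

end Model

/-! ### Inequalities between expectations -/

section Expectations

variable {n : Type*} [Fintype n] [DecidableEq n] {ρ : Matrix n n ℂ}

/-- Nonnegativity of the expectation of `Yᴴ * Y` for `Y = s - x U - y V`, written out. -/
theorem IsDensity.gram_nonneg (hρ : IsDensity ρ) {U V : Matrix n n ℂ} (hU : Uᴴ * U = 1)
    (hV : Vᴴ * V = 1) (s : ℝ) (x y : ℂ) :
    0 ≤ s ^ 2 + ‖x‖ ^ 2 + ‖y‖ ^ 2 - 2 * s * (x * (ρ * U).trace).re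
      - 2 * s * (y * (ρ * V).trace).re + 2 * (star x * y * (ρ * (Uᴴ * V)).trace).re := by
  have hVU : Vᴴ * U = (Uᴴ * V)ᴴ := by simp
  have h := (Complex.le_def.mp (hρ.trace_mul_nonneg ((s : ℂ) • 1 - x • U - y • V))).1
  simp only [conjTranspose_sub, conjTranspose_smul, conjTranspose_one, sub_mul, mul_sub,
    smul_mul_assoc, mul_smul_comm, one_mul, mul_one, hU, hV, hVU, trace_sub, trace_smul, hρ.2,
    hρ.trace_mul_conjTranspose, Complex.zero_re] at h
  refine h.trans (le_of_eq ?_)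
  have hx : ‖x‖ ^ 2 = x.re ^ 2 + x.im ^ 2 := by rw [Complex.sq_norm, Complex.normSq_apply]; ring
  have hy : ‖y‖ ^ 2 = y.re ^ 2 + y.im ^ 2 := by rw [Complex.sq_norm, Complex.normSq_apply]; ring
  rw [hx, hy]
  simp
  ring

theorem IsDensity.norm_trace_mul_le_one (hρ : IsDensity ρ) {U : Matrix n n ℂ} (hU : Uᴴ * U = 1) :
    ‖(ρ * U).trace‖ ≤ 1 := by
  have h := hρ.gram_nonneg hU hU 1 (star (ρ * U).trace) 0
  have h2 : (star (ρ * U).trace * (ρ * U).trace).re = ‖(ρ * U).trace‖ ^ 2 := by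
    rw [Complex.sq_norm, Complex.normSq_apply]; simp
  rw [h2] at h
  simp at h
  nlinarith [norm_nonneg (ρ * U).trace]

/-- Uncertainty relation for unitaries that commute up to the phase `ζ`. It is the average of the
positivity conditions for the two vectors `s - a Uᴴ - b̄ V` and `s - ā U - b Vᴴ`, in which
`⟨U V⟩` and `⟨V U⟩ = ζ ⟨U V⟩` occur. -/
theorem IsDensity.uncertainty (hρ : IsDensity ρ) {U V : Matrix n n ℂ} (hU : Uᴴ * U = 1)
    (hU' : U * Uᴴ = 1) (hV : Vᴴ * V = 1) (hV' : V * Vᴴ = 1) {ζ : ℂ}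
    (hVU : V * U = ζ • (U * V)) :
    (‖(ρ * U).trace‖ ^ 2 + ‖(ρ * V).trace‖ ^ 2) ^ 2 ≤
      ‖(ρ * U).trace‖ ^ 2 + ‖(ρ * V).trace‖ ^ 2 +
        ‖1 + ζ‖ * (‖(ρ * U).trace‖ * ‖(ρ * V).trace‖) := by
  have hsq : ∀ z : ℂ, (star z * z).re = ‖z‖ ^ 2 := fun z => by
    rw [Complex.sq_norm, Complex.normSq_apply]; simp
  have hsq' : ∀ z : ℂ, (z * star z).re = ‖z‖ ^ 2 := fun z => by rw [mul_comm, hsq]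
  set a := (ρ * U).trace with ha
  set b := (ρ * V).trace with hb
  set z := (ρ * (U * V)).trace with hz
  set s := ‖a‖ ^ 2 + ‖b‖ ^ 2 with hs
  have h1 := hρ.gram_nonneg (U := Uᴴ) (V := V) (by simpa using hU') hV s a (star b)
  have h2 := hρ.gram_nonneg (U := U) (V := Vᴴ) hU (by simpa using hV') s (star a) b
  have hUV : (ρ * (Uᴴ * Vᴴ)).trace = star (ζ * z) := by
    rw [← conjTranspose_mul, hρ.trace_mul_conjTranspose, hVU, mul_smul_comm, trace_smul,
      smul_eq_mul]
  rw [hρ.trace_mul_conjTranspose, conjTranspose_conjTranspose, ← ha, ← hb, ← hz, hsq', hsq,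
    norm_star] at h1
  rw [hρ.trace_mul_conjTranspose, hUV, ← ha, ← hb, hsq', hsq, norm_star, star_star] at h2
  have h3 : (a * b * star (ζ * z)).re = (star a * star b * (ζ * z)).re := by
    rw [← Complex.conj_re]; simp
  rw [h3] at h2
  have h4 : (star a * star b * z).re + (star a * star b * (ζ * z)).re ≤
      ‖1 + ζ‖ * (‖a‖ * ‖b‖) := by
    rw [← Complex.add_re, show star a * star b * z + star a * star b * (ζ * z) =
      (1 + ζ) * (star a * star b * z) by ring]
    refine (Complex.re_le_norm _).trans ?_
    have hz1 : ‖z‖ ≤ 1 := hρ.norm_trace_mul_le_one (by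
      rw [conjTranspose_mul, Matrix.mul_assoc, ← Matrix.mul_assoc _ U, hU, Matrix.one_mul, hV])
    rw [norm_mul, norm_mul, norm_mul, norm_star, norm_star]
    exact mul_le_mul_of_nonneg_left (mul_le_of_le_one_right (by positivity) hz1) (norm_nonneg _)
  nlinarith

/-- A projection `p` fixed by a unitary `S` bounds the expectation of `S` from below: the operator
`2 + S + Sᴴ - 4 p` is the square of `1 + S - 2 p`. -/
theorem IsDensity.two_mul_sub_one_le_re (hρ : IsDensity ρ) {S p : Matrix n n ℂ}
    (hS : Sᴴ * S = 1) (hp : pᴴ = p) (hpp : p * p = p) (hSp : S * p = p) :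
    2 * (ρ * p).trace.re - 1 ≤ (ρ * S).trace.re := by
  have hSp' : Sᴴ * p = p := by rw [← hSp, ← Matrix.mul_assoc, hS, Matrix.one_mul, hSp]
  have hpS : p * S = p := by
    have := congrArg conjTranspose hSp'
    rwa [conjTranspose_mul, conjTranspose_conjTranspose, hp] at this
  have h := (Complex.le_def.mp (hρ.trace_mul_nonneg (1 + S - (2 : ℂ) • p))).1
  have hY : (1 + S - (2 : ℂ) • p)ᴴ * (1 + S - (2 : ℂ) • p) =
      (2 : ℂ) • 1 + S + Sᴴ - (4 : ℂ) • p := by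
    simp only [conjTranspose_sub, conjTranspose_add, conjTranspose_one, conjTranspose_smul, hp,
      sub_mul, mul_sub, add_mul, mul_add, smul_mul_assoc, mul_smul_comm, one_mul, mul_one, hS,
      hSp', hpS, hpp, star_ofNat]
    module
  rw [hY] at h
  simp [mul_add, mul_sub, hρ.2, hρ.trace_mul_conjTranspose] at h
  linarith

/-- The union bound for two commuting projections. -/
theorem IsDensity.add_sub_one_le_re (hρ : IsDensity ρ) {p q : Matrix n n ℂ} (hp : pᴴ = p)
    (hpp : p * p = p) (hq : qᴴ = q) (hqq : q * q = q) (hpq : p * q = q * p) :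
    (ρ * p).trace.re + (ρ * q).trace.re - 1 ≤ (ρ * (p * q)).trace.re := by
  have h := (Complex.le_def.mp (hρ.trace_mul_nonneg ((1 - p) * (1 - q)))).1
  have hY : ((1 - p) * (1 - q))ᴴ * ((1 - p) * (1 - q)) = 1 - p - q + p * q := by
    have h1 : (1 - q) * (1 - p) * ((1 - p) * (1 - q)) =
      (1 - q) * ((1 - p) * (1 - p)) * (1 - q) := by simp only [Matrix.mul_assoc]
    have h2 : (1 - p) * (1 - p) = 1 - p := by
      simp only [sub_mul, mul_sub, one_mul, mul_one, hpp]; abel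
    have h3 : (1 - q) * (1 - q) = 1 - q := by
      simp only [sub_mul, mul_sub, one_mul, mul_one, hqq]; abel
    have h4 : (1 - q) * (1 - p) = (1 - p) * (1 - q) := by
      simp only [sub_mul, mul_sub, one_mul, mul_one, hpq]; abel
    rw [conjTranspose_mul, conjTranspose_sub, conjTranspose_sub, conjTranspose_one, hp, hq, h1, h2,
      h4, Matrix.mul_assoc, h3]
    simp only [sub_mul, mul_sub, one_mul, mul_one]; abel
  rw [hY] at h
  simp [mul_add, mul_sub, hρ.2] at h
  linarith

end Expectations

/-! ### The projection onto the fixed space of a unitary of finite order -/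

section FixedSpace

variable {n : Type*} [Fintype n] [DecidableEq n]

/-- The average of the powers `P ^ k`, `k < d`. For unitary `P` with `P ^ d = 1` it is the
orthogonal projection onto the vectors fixed by `P`. -/
noncomputable def fixedProj (d : ℕ) (P : Matrix n n ℂ) : Matrix n n ℂ :=
  (d : ℂ)⁻¹ • ∑ k ∈ Finset.range d, P ^ k

variable {d : ℕ} {P : Matrix n n ℂ}

theorem mul_fixedProj (hP : P ^ d = 1) : P * fixedProj d P = fixedProj d P := by
  rw [fixedProj, mul_smul_comm, Finset.mul_sum]
  congr 1
  have h := Finset.sum_range_succ (fun k => P ^ k) d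
  rw [Finset.sum_range_succ', hP, pow_zero] at h
  simpa only [← pow_succ'] using add_right_cancel h

theorem fixedProj_mul [NeZero d] {X : Matrix n n ℂ} (hX : P * X = X) : fixedProj d P * X = X := by
  have hk : ∀ k, P ^ k * X = X := fun k => by
    induction k with
    | zero => simp
    | succ k ih => rw [pow_succ, Matrix.mul_assoc, hX, ih]
  have hd : (d : ℂ) ≠ 0 := Nat.cast_ne_zero.mpr (NeZero.ne d)
  rw [fixedProj, smul_mul_assoc, Finset.sum_mul, Finset.sum_congr rfl fun k _ => hk k,
    Finset.sum_const, Finset.card_range, ← Nat.cast_smul_eq_nsmul ℂ, smul_smul,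
    inv_mul_cancel₀ hd, one_smul]

theorem fixedProj_mul_self [NeZero d] (hP : P ^ d = 1) :
    fixedProj d P * fixedProj d P = fixedProj d P :=
  fixedProj_mul (mul_fixedProj hP)

theorem fixedProj_conjTranspose [NeZero d] (hP : P ^ d = 1) (hU : Pᴴ * P = 1) :
    (fixedProj d P)ᴴ = fixedProj d P := by
  have h1 : Pᴴ * fixedProj d P = fixedProj d P := by
    conv_lhs => rw [← mul_fixedProj hP]
    rw [← Matrix.mul_assoc, hU, Matrix.one_mul]
  -- `pᴴ * p = p`, and the left-hand side is Hermitian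
  have h2 : (fixedProj d P)ᴴ * fixedProj d P = fixedProj d P := by
    have h3 : (fixedProj d P)ᴴ = fixedProj d Pᴴ := by
      simp [fixedProj, conjTranspose_sum, conjTranspose_pow]
    rw [h3, fixedProj_mul h1]
  have h4 := congrArg conjTranspose h2
  rw [conjTranspose_mul, conjTranspose_conjTranspose, h2] at h4
  exact h4.symm

theorem fixedProj_commute {Q : Matrix n n ℂ} (h : Commute P Q) :
    Commute (fixedProj d P) (fixedProj d Q) := by
  refine ((Commute.sum_left _ _ _ fun k _ => ?_).smul_left _)
  refine ((Commute.sum_right _ _ _ fun k _ => ?_).smul_right _)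
  exact h.pow_pow _ _

end FixedSpace

/-! ### Pure states -/

section KetBra

theorem ketBra_conjTranspose {n : Type*} (ψ : n → ℂ) : (ketBra ψ)ᴴ = ketBra ψ := by
  simp [ketBra, conjTranspose_vecMulVec]

variable {n : Type*} [Fintype n] {ψ : n → ℂ}

theorem mul_ketBra {S : Matrix n n ℂ} (hS : S *ᵥ ψ = ψ) : S * ketBra ψ = ketBra ψ := by
  rw [ketBra, mul_vecMulVec, hS]

theorem star_dotProduct_self (hψ : ∑ x, ‖ψ x‖ ^ 2 = 1) : star ψ ⬝ᵥ ψ = 1 := by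
  have : star ψ ⬝ᵥ ψ = ((∑ x, ‖ψ x‖ ^ 2 : ℝ) : ℂ) := by
    simp only [dotProduct, Pi.star_apply]
    push_cast
    exact Finset.sum_congr rfl fun x _ => Complex.conj_mul' _
  rw [this, hψ, Complex.ofReal_one]

theorem ketBra_mul_self (hψ : ∑ x, ‖ψ x‖ ^ 2 = 1) : ketBra ψ * ketBra ψ = ketBra ψ := by
  rw [ketBra, vecMulVec_mul_vecMulVec, star_dotProduct_self hψ, one_smul]

theorem pureFidelity_eq (ψ : n → ℂ) (ρ : Matrix n n ℂ) :
    pureFidelity ψ ρ = (ρ * ketBra ψ).trace.re := by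
  rw [pureFidelity, ketBra, mul_vecMulVec, trace_vecMulVec, dotProduct_comm]

end KetBra

/-! ### The constraint on the fidelity -/

section Fidelity

theorem tensorProd_conjTranspose_mul_self {V : Type*} [Fintype V] [DecidableEq V] {I : V → Type*}
    [∀ v, Fintype (I v)] [∀ v, DecidableEq (I v)] {A : ∀ v, Matrix (I v) (I v) ℂ}
    (hA : ∀ v, (A v)ᴴ * A v = 1) : (tensorProd A)ᴴ * tensorProd A = 1 := by
  simp only [tensorProd_conjTranspose, tensorProd_mul, hA, tensorProd_one]

/-- A bound by the fidelity on the expectation of a stabilizing unitary. -/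
theorem IsDensity.two_mul_fidelity_sub_one_le {n : Type*} [Fintype n] [DecidableEq n]
    {ρ : Matrix n n ℂ} (hρ : IsDensity ρ) {ψ : n → ℂ} (hψ : ∑ x, ‖ψ x‖ ^ 2 = 1)
    {S : Matrix n n ℂ} (hS : Sᴴ * S = 1) (hSψ : S *ᵥ ψ = ψ) :
    2 * pureFidelity ψ ρ - 1 ≤ ‖(ρ * S).trace‖ := by
  rw [pureFidelity_eq]
  exact (hρ.two_mul_sub_one_le_re hS (ketBra_conjTranspose ψ) (ketBra_mul_self hψ)
    (mul_ketBra hSψ)).trans (Complex.re_le_norm _)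

variable {V : Type*} [Fintype V] [DecidableEq V] {N : QNetwork V} {d : ℕ} [NeZero d]

/-- Two commuting stabilizers `⨂ p v` and `⨂ q v`, the first trivial on `C`, the second on `A`,
whose product is supported on `A ∪ C`: in a network state of high fidelity, the part of the first
one on `A` alone has an expectation close to one in modulus, since in the cut inflation the
expectation of the product is high and factorizes. -/
theorem CQNModel.four_mul_fidelity_sub_three_le (M : CQNModel N d) (l : M.Λ) (hN : N.IsBipartite)
    {ψ : (V → ZMod d) → ℂ} (hψ : ∑ x, ‖ψ x‖ ^ 2 = 1) {A C : Finset V} (hAC : Disjoint A C)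
    {p q : V → Matrix (ZMod d) (ZMod d) ℂ} (hpC : ∀ v ∈ C, p v = 1) (hqA : ∀ v ∈ A, q v = 1)
    (hpq : ∀ v, v ∉ A → v ∉ C → p v * q v = 1)
    (hp : ∀ v, (p v)ᴴ * p v = 1) (hq : ∀ v, (q v)ᴴ * q v = 1)
    (hpd : tensorProd p ^ d = 1) (hqd : tensorProd q ^ d = 1)
    (hcomm : Commute (tensorProd p) (tensorProd q))
    (hpψ : tensorProd p *ᵥ ψ = ψ) (hqψ : tensorProd q *ᵥ ψ = ψ) :
    4 * pureFidelity ψ (M.state l) - 3 ≤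
      ‖(M.state l * tensorProd fun v => if v ∈ A then p v else 1).trace‖ := by
  obtain ⟨η, hη, hηC, hηA, hηAC⟩ := M.exists_cut l hN hAC
  have hρ := M.isDensity_state l
  set P := tensorProd p with hPdef
  set Q := tensorProd q with hQdef
  have hPu : Pᴴ * P = 1 := tensorProd_conjTranspose_mul_self hp
  have hQu : Qᴴ * Q = 1 := tensorProd_conjTranspose_mul_self hq
  -- the projections onto the fixed spaces of `P` and `Q` are visible in the marginals
  have hηP : (η * fixedProj d P).trace = (M.state l * fixedProj d P).trace := by
    simp only [fixedProj, mul_smul_comm, Finset.mul_sum, trace_smul, trace_sum]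
    congr 1
    refine Finset.sum_congr rfl fun k _ => ?_
    rw [hPdef, tensorProd_pow]
    exact hηC _ fun v hv => by rw [hpC v hv, one_pow]
  have hηQ : (η * fixedProj d Q).trace = (M.state l * fixedProj d Q).trace := by
    simp only [fixedProj, mul_smul_comm, Finset.mul_sum, trace_smul, trace_sum]
    congr 1
    refine Finset.sum_congr rfl fun k _ => ?_
    rw [hQdef, tensorProd_pow]
    exact hηA _ fun v hv => by rw [hqA v hv, one_pow]
  have hF : ∀ S : Matrix (V → ZMod d) (V → ZMod d) ℂ, Sᴴ * S = 1 → S ^ d = 1 → S *ᵥ ψ = ψ →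
      pureFidelity ψ (M.state l) ≤ (M.state l * fixedProj d S).trace.re := by
    intro S hS hSd hSψ
    rw [pureFidelity_eq]
    exact hρ.re_trace_le (fixedProj_conjTranspose hSd hS) (fixedProj_mul_self hSd)
      (ketBra_conjTranspose ψ) (ketBra_mul_self hψ) (fixedProj_mul (mul_ketBra hSψ))
  have h1 := hF P hPu hpd hpψ
  have h2 := hF Q hQu hqd hqψ
  rw [← hηP] at h1
  rw [← hηQ] at h2
  have hc : Commute (fixedProj d P) (fixedProj d Q) := fixedProj_commute hcomm
  have hPh := fixedProj_conjTranspose hpd hPu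
  have hQh := fixedProj_conjTranspose hqd hQu
  have hPP := fixedProj_mul_self hpd
  have hQQ := fixedProj_mul_self hqd
  have h3 := hη.add_sub_one_le_re hPh hPP hQh hQQ hc.eq
  have h4 : 2 * (η * (fixedProj d P * fixedProj d Q)).trace.re - 1 ≤ (η * (P * Q)).trace.re := by
    refine hη.two_mul_sub_one_le_re ?_ ?_ ?_ ?_
    · rw [conjTranspose_mul, Matrix.mul_assoc, ← Matrix.mul_assoc _ P, hPu, Matrix.one_mul, hQu]
    · rw [conjTranspose_mul, hPh, hQh, hc.eq]
    · rw [Matrix.mul_assoc, ← Matrix.mul_assoc _ (fixedProj d P), ← hc.eq, Matrix.mul_assoc, hQQ,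
        ← Matrix.mul_assoc, hPP]
    · rw [hc.eq, Matrix.mul_assoc, ← Matrix.mul_assoc _ _ (fixedProj d P), mul_fixedProj hqd,
        ← hc.eq, ← Matrix.mul_assoc, mul_fixedProj hpd]
  -- the product observable factorizes over `A` and `C`
  have h5 : (η * (P * Q)).trace =
      (M.state l * tensorProd fun v => if v ∈ A then p v else 1).trace *
        (M.state l * tensorProd fun v => if v ∈ C then q v else 1).trace := by
    rw [← hηAC _ _ (fun v hv => if_neg hv) fun v hv => if_neg hv, hPdef, hQdef, tensorProd_mul]
    congr 3
    ext1 v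
    by_cases hA : v ∈ A
    · simp [hA, hqA v hA, Finset.disjoint_left.mp hAC hA]
    · by_cases hC : v ∈ C
      · simp [hA, hC, hpC v hC]
      · simp [hA, hC, hpq v hA hC]
  have h6 : ‖(M.state l * tensorProd fun v => if v ∈ C then q v else 1).trace‖ ≤ 1 := by
    refine hρ.norm_trace_mul_le_one (tensorProd_conjTranspose_mul_self fun v => ?_)
    split_ifs
    · exact hq v
    · simp
  have h7 := Complex.re_le_norm (η * (P * Q)).trace
  rw [h5, norm_mul, ← h5] at h7
  have h8 := mul_le_of_le_one_right
    (norm_nonneg (M.state l * tensorProd fun v => if v ∈ A then p v else 1).trace) h6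
  linarith

/-- The relation between the moduli `a`, `b` of the expectations of two observables, bounded from
below in terms of the fidelity `F`, from which all bounds on `F` follow. The parameter `c` is
`|1 + ζ| / 2` for the phase `ζ` up to which the two observables commute. -/
def FidelityConstraint (c F : ℝ) : Prop :=
  ∃ a b : ℝ, 0 ≤ a ∧ 0 ≤ b ∧ 4 * F - 3 ≤ a ∧ 2 * F - 1 ≤ b ∧
    (a ^ 2 + b ^ 2) ^ 2 ≤ a ^ 2 + b ^ 2 + 2 * c * (a * b)

/-- The constraint obtained from stabilizers `⨂ p v`, `⨂ q v` as in
`CQNModel.four_mul_fidelity_sub_three_le` and a stabilizer `⨂ r v` that commutes with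
the part of the first one on `A` up to a phase arising at `v₀`. -/
theorem CQNModel.fidelityConstraint (M : CQNModel N d) (l : M.Λ) (hN : N.IsBipartite)
    {ψ : (V → ZMod d) → ℂ} (hψ : ∑ x, ‖ψ x‖ ^ 2 = 1) {A C : Finset V} (hAC : Disjoint A C)
    {p q r : V → Matrix (ZMod d) (ZMod d) ℂ} (hpC : ∀ v ∈ C, p v = 1) (hqA : ∀ v ∈ A, q v = 1)
    (hpq : ∀ v, v ∉ A → v ∉ C → p v * q v = 1)
    (hp : ∀ v, (p v)ᴴ * p v = 1) (hq : ∀ v, (q v)ᴴ * q v = 1) (hr : ∀ v, (r v)ᴴ * r v = 1)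
    (hpd : tensorProd p ^ d = 1) (hqd : tensorProd q ^ d = 1)
    (hcomm : Commute (tensorProd p) (tensorProd q)) (hpψ : tensorProd p *ᵥ ψ = ψ)
    (hqψ : tensorProd q *ᵥ ψ = ψ) (hrψ : tensorProd r *ᵥ ψ = ψ)
    {v₀ : V} (hv₀ : v₀ ∈ A) {ζ : ℂ} (hζ : r v₀ * p v₀ = ζ • (p v₀ * r v₀))
    (hrp : ∀ v ∈ A, v ≠ v₀ → r v * p v = p v * r v) {c : ℝ} (hc : ‖1 + ζ‖ = 2 * c) :
    FidelityConstraint c (pureFidelity ψ (M.state l)) := by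
  set u : V → Matrix (ZMod d) (ZMod d) ℂ := fun v => if v ∈ A then p v else 1 with hu
  have huu : ∀ v, (u v)ᴴ * u v = 1 := fun v => by
    by_cases hv : v ∈ A
    · simp [hu, hv, hp]
    · simp [hu, hv]
  have hru : tensorProd r * tensorProd u = ζ • (tensorProd u * tensorProd r) := by
    have h : (fun v => r v * u v) = fun v => (if v = v₀ then ζ else 1) • (u v * r v) := by
      ext1 v
      by_cases hv : v = v₀
      · subst hv
        simp [hu, hv₀, hζ]
      · by_cases hA : v ∈ A
        · simp [hu, hA, hv, hrp v hA hv]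
        · simp [hu, hA, hv]
    rw [tensorProd_mul, h, tensorProd_smul, tensorProd_mul]
    simp
  have hR := tensorProd_conjTranspose_mul_self hr
  have hU := tensorProd_conjTranspose_mul_self huu
  refine ⟨_, _, norm_nonneg _, norm_nonneg _,
    M.four_mul_fidelity_sub_three_le l hN hψ hAC hpC hqA hpq hp hq hpd hqd hcomm hpψ hqψ,
    (M.isDensity_state l).two_mul_fidelity_sub_one_le hψ hR hrψ, ?_⟩
  rw [← hc]
  exact (M.isDensity_state l).uncertainty hU (mul_eq_one_comm.mp hU) hR (mul_eq_one_comm.mp hR) hru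

theorem FidelityConstraint.sq_add_sq_le {c F : ℝ} (hc : 0 ≤ c) (h : FidelityConstraint c F)
    (hF : 3 / 4 ≤ F) : (4 * F - 3) ^ 2 + (2 * F - 1) ^ 2 ≤ 1 + c := by
  obtain ⟨a, b, ha, hb, hFa, hFb, hab⟩ := h
  have h1 : (a ^ 2 + b ^ 2) * (a ^ 2 + b ^ 2) ≤ (1 + c) * (a ^ 2 + b ^ 2) := by
    nlinarith [mul_nonneg hc (sq_nonneg (a - b))]
  have hb0 : 0 < b := by linarith
  have h2 : a ^ 2 + b ^ 2 ≤ 1 + c := le_of_mul_le_mul_right h1 (by positivity)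
  have h3 : (4 * F - 3) ^ 2 ≤ a ^ 2 := pow_le_pow_left₀ (by linarith) hFa 2
  have h4 : (2 * F - 1) ^ 2 ≤ b ^ 2 := pow_le_pow_left₀ (by linarith) hFb 2
  linarith

/-- The right-hand side is the larger root of `(4 F - 3) ^ 2 + (2 F - 1) ^ 2 = 1 + c`. -/
theorem FidelityConstraint.le_sqrt {c F : ℝ} (hc : 0 ≤ c) (h : FidelityConstraint c F) :
    F ≤ (7 + Real.sqrt (4 + 5 * c)) / 10 := by
  rcases le_total F (3 / 4) with hF | hF
  · have : 0 ≤ Real.sqrt (4 + 5 * c) := Real.sqrt_nonneg _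
    have : 2 ≤ Real.sqrt (4 + 5 * c) := Real.le_sqrt_of_sq_le (by linarith)
    linarith
  · have h1 := h.sq_add_sq_le hc hF
    have : 10 * F - 7 ≤ Real.sqrt (4 + 5 * c) := Real.le_sqrt_of_sq_le (by nlinarith)
    linarith

/-- At `c = 1 / 2`, where the bound of `FidelityConstraint.le_sqrt` exceeds `0.95495`, a better one
holds because the two lower bounds `4 * F - 3` and `2 * F - 1` differ. -/
theorem FidelityConstraint.le_of_le_half {c F : ℝ} (hc : c ≤ 1 / 2)
    (h : FidelityConstraint c F) : F ≤ 0.9549 := by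
  by_contra! hF
  obtain ⟨a, b, ha, hb, hFa, hFb, hab⟩ := h
  -- the values of `4 * F - 3` and `2 * F - 1` at `F = 0.9549`
  have ha' : 0.8196 ≤ a := by norm_num at hF ⊢; linarith
  have hb' : 0.9098 ≤ b := by norm_num at hF ⊢; linarith
  have h1 : (a ^ 2 + b ^ 2) ^ 2 ≤ a ^ 2 + b ^ 2 + a * b := by
    nlinarith [mul_nonneg ha hb]
  norm_num at ha' hb'
  -- `s ^ 2 - s - a * b` is increasing in `a` and `b` beyond these bounds
  obtain ⟨x, hx, rfl⟩ : ∃ x, 0 ≤ x ∧ a = 2049 / 2500 + x := ⟨a - 2049 / 2500, by linarith, by ring⟩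
  obtain ⟨y, hy, rfl⟩ : ∃ y, 0 ≤ y ∧ b = 4549 / 5000 + y := ⟨b - 4549 / 5000, by linarith, by ring⟩
  have hxy := mul_nonneg hx hy
  have : 0 ≤ x ^ 4 + y ^ 4 + 2 * x ^ 2 * y ^ 2 + x ^ 3 + x ^ 2 * y + x * y ^ 2 + y ^ 3 := by
    positivity
  nlinarith [pow_nonneg hx 2, pow_nonneg hx 3, pow_nonneg hx 4, pow_nonneg hy 2, pow_nonneg hy 3,
    pow_nonneg hy 4, mul_nonneg hxy hx, mul_nonneg hxy hy, mul_nonneg hxy hxy]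

end Fidelity

/-! ### Clock and shift operators -/

section Pauli

variable {d : ℕ}

/-- The root of unity `ω = exp (2 π i / d)` of the clock operator. -/
noncomputable def clockRoot (d : ℕ) : ℂ := Complex.exp (2 * Real.pi * Complex.I / d)

theorem clockRoot_pow_self [NeZero d] : clockRoot d ^ d = 1 := by
  have hd : (d : ℂ) ≠ 0 := Nat.cast_ne_zero.mpr (NeZero.ne d)
  rw [clockRoot, ← Complex.exp_nat_mul, mul_div_cancel₀ _ hd, Complex.exp_two_pi_mul_I]

theorem norm_one_add_clockRoot_pow (k : ℕ) :
    ‖1 + clockRoot d ^ k‖ = 2 * |Real.cos (k * Real.pi / d)| := by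
  have h : 1 + clockRoot d ^ k = Complex.exp ((k * Real.pi / d : ℝ) * Complex.I) *
      (2 * Complex.cos (k * Real.pi / d : ℝ)) := by
    rw [Complex.two_cos, mul_add, ← Complex.exp_add, ← Complex.exp_add, clockRoot,
      ← Complex.exp_nat_mul, add_comm (1 : ℂ)]
    congr 1
    · congr 1
      push_cast
      ring
    · rw [neg_mul, add_neg_cancel, Complex.exp_zero]
  rw [h, norm_mul, Complex.norm_exp_ofReal_mul_I, one_mul, norm_mul, ← Complex.ofReal_cos,
    Complex.norm_real, Real.norm_eq_abs, Complex.norm_two]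

variable [NeZero d]

theorem shiftX_pow_apply (k : ℕ) (p q : ZMod d) :
    (shiftX d ^ k) p q = if p = q + k then 1 else 0 := by
  induction k generalizing p q with
  | zero => simp [one_apply]
  | succ k ih =>
    rw [pow_succ, mul_apply, Fintype.sum_eq_single (q + 1)]
    · have h : shiftX d (q + 1) q = 1 := if_pos rfl
      rw [ih, h, mul_one, add_assoc, Nat.cast_succ, add_comm (1 : ZMod d)]
    · intro r hr
      simp [shiftX, hr]

theorem shiftX_pow_self : shiftX d ^ d = 1 := by
  ext p q
  simp [shiftX_pow_apply, one_apply]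

theorem shiftX_conjTranspose_mul_self : (shiftX d)ᴴ * shiftX d = 1 := by
  ext p q
  rw [mul_apply, Fintype.sum_eq_single (q + 1)]
  · simp [shiftX, one_apply, conjTranspose_apply, eq_comm]
  · intro r hr
    simp [shiftX, hr]

theorem clockZ_pow_self : clockZ d ^ d = 1 := by
  rw [clockZ, diagonal_pow, ← diagonal_one]
  congr 1
  ext q
  change (clockRoot d ^ q.val) ^ d = 1
  rw [← pow_mul, mul_comm, pow_mul, clockRoot_pow_self, one_pow]

theorem clockZ_conjTranspose_mul_self : (clockZ d)ᴴ * clockZ d = 1 := by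
  rw [clockZ, diagonal_conjTranspose, diagonal_mul_diagonal, ← diagonal_one]
  congr 1
  ext q
  have h : ‖Complex.exp (2 * Real.pi * Complex.I / d)‖ = 1 := by
    rw [show 2 * Real.pi * Complex.I / d = ((2 * Real.pi / d : ℝ) : ℂ) * Complex.I by
      push_cast; ring]
    exact Complex.norm_exp_ofReal_mul_I _
  rw [Pi.star_apply]
  refine (Complex.conj_mul' _).trans ?_
  rw [norm_pow, h]
  simp

theorem clockZ_mul_shiftX : clockZ d * shiftX d = clockRoot d • (shiftX d * clockZ d) := by
  ext p q
  rw [clockZ, diagonal_mul, Matrix.smul_apply, mul_diagonal]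
  by_cases h : p = q + 1
  · subst h
    have h1 : clockRoot d ^ (q + 1).val = clockRoot d ^ (q.val + 1) := by
      rw [ZMod.val_add, ZMod.val_one_eq_one_mod, Nat.add_mod_mod,
        ← pow_eq_pow_mod _ clockRoot_pow_self]
    simp only [shiftX, of_apply, if_true, mul_one, one_mul, smul_eq_mul]
    exact h1.trans (pow_succ' _ _)
  · simp [shiftX, h]

theorem pow_mul_pow_of_mul_eq_smul {n : Type*} [Fintype n] [DecidableEq n] {A B : Matrix n n ℂ}
    {z : ℂ} (h : B * A = z • (A * B)) (i j : ℕ) :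
    B ^ i * A ^ j = z ^ (i * j) • (A ^ j * B ^ i) := by
  have h1 : ∀ j, B * A ^ j = z ^ j • (A ^ j * B) := fun j => by
    induction j with
    | zero => simp
    | succ j ih =>
      rw [pow_succ, ← Matrix.mul_assoc, ih, smul_mul_assoc, Matrix.mul_assoc, h, mul_smul_comm,
        smul_smul, ← Matrix.mul_assoc, ← pow_succ]
  induction i with
  | zero => simp
  | succ i ih =>
    rw [pow_succ, Matrix.mul_assoc, h1, mul_smul_comm, ← Matrix.mul_assoc, ih, smul_mul_assoc,
      smul_smul, Matrix.mul_assoc, ← pow_succ, ← pow_add, add_mul, one_mul, add_comm]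

theorem clockZ_pow_mul_shiftX_pow (i j : ℕ) :
    clockZ d ^ i * shiftX d ^ j = clockRoot d ^ (i * j) • (shiftX d ^ j * clockZ d ^ i) :=
  pow_mul_pow_of_mul_eq_smul clockZ_mul_shiftX i j

theorem pow_conjTranspose_mul_pow {n : Type*} [Fintype n] [DecidableEq n] {A : Matrix n n ℂ}
    (hA : Aᴴ * A = 1) (k : ℕ) : (A ^ k)ᴴ * A ^ k = 1 := by
  have h : Commute Aᴴ A := hA.trans (mul_eq_one_comm.mp hA).symm
  rw [conjTranspose_pow, ← h.mul_pow, hA, one_pow]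

theorem mul_conjTranspose_mul_mul {n : Type*} [Fintype n] [DecidableEq n] {A B : Matrix n n ℂ}
    (hA : Aᴴ * A = 1) (hB : Bᴴ * B = 1) : (A * B)ᴴ * (A * B) = 1 := by
  rw [conjTranspose_mul, Matrix.mul_assoc, ← Matrix.mul_assoc _ A, hA, Matrix.one_mul, hB]

theorem pow_mulVec_eq {n : Type*} [Fintype n] [DecidableEq n] {A : Matrix n n ℂ} {ψ : n → ℂ}
    (h : A *ᵥ ψ = ψ) (k : ℕ) : A ^ k *ᵥ ψ = ψ := by
  induction k with
  | zero => simp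
  | succ k ih => rw [pow_succ, ← mulVec_mulVec, h, ih]

/-- When `x ^ d = 1`, the power `t * (d - 1)` is the inverse of the power `t`. -/
theorem pow_mul_pow_mul_pred {M : Type*} [Monoid M] {x : M} (hx : x ^ d = 1) (t : ℕ) :
    x ^ t * x ^ (t * (d - 1)) = 1 := by
  obtain ⟨e, he⟩ : ∃ e, d = e + 1 := Nat.exists_eq_succ_of_ne_zero (NeZero.ne d)
  rw [← pow_add, show t + t * (d - 1) = d * t by rw [he, Nat.add_sub_cancel]; ring, pow_mul, hx,
    one_pow]

end Pauli

/-! ### Stabilizers of a multigraph -/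

section Stabilizer

variable {V : Type*} [DecidableEq V] (G : QMultigraph V) (d : ℕ) [NeZero d]

/-- The tensor factor at `v` of the stabilizer of the vertex `i`. -/
noncomputable def QMultigraph.localStabilizer (i v : V) : Matrix (ZMod d) (ZMod d) ℂ :=
  if v = i then shiftX d else clockZ d ^ G.mult i v

variable {G d}

theorem localStabilizer_self (i : V) : G.localStabilizer d i i = shiftX d := if_pos rfl

theorem localStabilizer_of_ne {i v : V} (h : v ≠ i) :
    G.localStabilizer d i v = clockZ d ^ G.mult i v := if_neg h

theorem localStabilizer_conjTranspose_mul_self (i v : V) :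
    (G.localStabilizer d i v)ᴴ * G.localStabilizer d i v = 1 := by
  unfold QMultigraph.localStabilizer
  split_ifs
  · exact shiftX_conjTranspose_mul_self
  · exact pow_conjTranspose_mul_pow clockZ_conjTranspose_mul_self _

theorem localStabilizer_pow_self (i v : V) : G.localStabilizer d i v ^ d = 1 := by
  unfold QMultigraph.localStabilizer
  split_ifs
  · exact shiftX_pow_self
  · rw [← pow_mul, mul_comm, pow_mul, clockZ_pow_self, one_pow]

variable [Fintype V]

theorem stabilizer_eq (i : V) : G.stabilizer d i = tensorProd (G.localStabilizer d i) := rfl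

theorem stabilizer_pow_eq (i : V) (k : ℕ) :
    G.stabilizer d i ^ k = tensorProd fun v => G.localStabilizer d i v ^ k := by
  rw [stabilizer_eq, tensorProd_pow]

theorem stabilizer_pow_self (i : V) : G.stabilizer d i ^ d = 1 := by
  simp only [stabilizer_pow_eq, localStabilizer_pow_self, tensorProd_one]

theorem stabilizer_commute (i j : V) : Commute (G.stabilizer d i) (G.stabilizer d j) := by
  by_cases hij : i = j
  · subst hij
    exact Commute.refl _
  have hω : clockRoot d ≠ 0 := Complex.exp_ne_zero _
  -- the phases arising at `i` and at `j` are inverse to each other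
  have h : (fun v => G.localStabilizer d i v * G.localStabilizer d j v) = fun v =>
      ((if v = i then (clockRoot d ^ G.mult i j)⁻¹ else 1) *
        (if v = j then clockRoot d ^ G.mult i j else 1)) •
        (G.localStabilizer d j v * G.localStabilizer d i v) := by
    ext1 v
    have hx := clockZ_pow_mul_shiftX_pow (d := d) (G.mult i j) 1
    rw [pow_one, mul_one] at hx
    by_cases hi : v = i
    · subst hi
      rw [localStabilizer_self, localStabilizer_of_ne hij, G.symm j v, hx, smul_smul, if_pos rfl,
        if_neg hij, mul_one, inv_mul_cancel₀ (pow_ne_zero _ hω), one_smul]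
    · by_cases hj : v = j
      · subst hj
        rw [localStabilizer_self, localStabilizer_of_ne hi, hx, if_neg hi, if_pos rfl, one_mul]
      · rw [localStabilizer_of_ne hi, localStabilizer_of_ne hj, if_neg hi, if_neg hj, one_mul,
          one_smul, ← pow_add, ← pow_add, add_comm]
  rw [Commute, SemiconjBy, stabilizer_eq, stabilizer_eq, tensorProd_mul, h, tensorProd_smul,
    tensorProd_mul, Finset.prod_mul_distrib]
  simp [hω]

end Stabilizer

/-! ### The constraint for graph states -/

section GraphState

variable {V : Type*} [Fintype V] [DecidableEq V] {N : QNetwork V} {d : ℕ} [NeZero d] {m : ℕ}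
  {G : QMultigraph V} {ψ : (V → ZMod d) → ℂ}

/-- The constraint for an induced path `a - b - c`: the stabilizers of `a` and `c` cancel on the
common neighbours of `a` and `c`, and the stabilizer of `b` does not commute with that of `a` at
the vertex `a` only. -/
theorem CQNModel.fidelityConstraint_of_induced_path (M : CQNModel N d) (l : M.Λ)
    (hN : N.IsBipartite) (hmult : ∀ i j, G.mult i j = m ∨ G.mult i j = 0)
    (hψ : G.IsGraphState ψ) {a b c : V} (hab : G.mult a b ≠ 0) (hcb : G.mult c b ≠ 0)
    (hac : G.mult a c = 0) (hne : a ≠ c) (t : ℕ) :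
    FidelityConstraint |Real.cos (t * m * Real.pi / d)| (pureFidelity ψ (M.state l)) := by
  have hca : G.mult c a = 0 := by rw [G.symm, hac]
  have hba : b ≠ a := by rintro rfl; exact hab (G.loopless _)
  have hbm : G.mult b a = m := (hmult b a).resolve_right (by rwa [G.symm])
  have hzero : ∀ i v k, v ≠ i → G.mult i v = 0 → G.localStabilizer d i v ^ k = 1 := by
    intro i v k hv h0
    rw [localStabilizer_of_ne hv, h0, pow_zero, one_pow]
  have hu := fun i v k => pow_conjTranspose_mul_pow
    (localStabilizer_conjTranspose_mul_self (G := G) (d := d) i v) k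
  have hc : ‖1 + clockRoot d ^ (m * t)‖ = 2 * |Real.cos (t * m * Real.pi / d)| := by
    rw [norm_one_add_clockRoot_pow]
    push_cast
    rw [mul_comm (m : ℝ)]
  refine M.fidelityConstraint l hN hψ.1
    (A := {v | v = a ∨ G.mult a v ≠ 0 ∧ G.mult c v = 0})
    (C := {v | v = c ∨ G.mult c v ≠ 0 ∧ G.mult a v = 0})
    (p := fun v => G.localStabilizer d a v ^ t)
    (q := fun v => G.localStabilizer d c v ^ (t * (d - 1)))
    (r := fun v => G.localStabilizer d b v) (v₀ := a)
    ?_ ?_ ?_ ?_ (hu a · t) (hu c · _) (localStabilizer_conjTranspose_mul_self b)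
    ?_ ?_ ?_ ?_ ?_ (hψ.2 b) (by simp) ?_ ?_ hc
  · rw [Finset.disjoint_left]
    intro v hv hv'
    simp only [Finset.mem_filter, Finset.mem_univ, true_and] at hv hv'
    rcases hv with rfl | hv <;> rcases hv' with rfl | hv' <;> simp_all
  · intro v hv
    simp only [Finset.mem_filter, Finset.mem_univ, true_and] at hv
    rcases hv with rfl | hv
    · exact hzero _ _ _ hne.symm hac
    · exact hzero _ _ _ (by rintro rfl; exact hv.1 hca) hv.2
  · intro v hv
    simp only [Finset.mem_filter, Finset.mem_univ, true_and] at hv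
    rcases hv with rfl | hv
    · exact hzero _ _ _ hne hca
    · exact hzero _ _ _ (by rintro rfl; exact hv.1 hac) hv.2
  · intro v hva hvc
    simp only [Finset.mem_filter, Finset.mem_univ, true_and, not_or, not_and] at hva hvc
    have h : G.localStabilizer d a v = G.localStabilizer d c v := by
      rw [localStabilizer_of_ne hva.1, localStabilizer_of_ne hvc.1]
      rcases hmult a v with h1 | h1 <;> rcases hmult c v with h2 | h2
      · rw [h1, h2]
      · rw [h2, not_not.mp fun h => hva.2 h h2]
      · rw [h1, not_not.mp fun h => hvc.2 h h1]
      · rw [h1, h2]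
    rw [h]
    exact pow_mul_pow_mul_pred (localStabilizer_pow_self c v) t
  · rw [← stabilizer_pow_eq, ← pow_mul, mul_comm, pow_mul, stabilizer_pow_self, one_pow]
  · rw [← stabilizer_pow_eq, ← pow_mul, mul_comm, pow_mul, stabilizer_pow_self, one_pow]
  · rw [← stabilizer_pow_eq, ← stabilizer_pow_eq]
    exact (stabilizer_commute a c).pow_pow _ _
  · rw [← stabilizer_pow_eq]
    exact pow_mulVec_eq (hψ.2 a) _
  · rw [← stabilizer_pow_eq]
    exact pow_mulVec_eq (hψ.2 c) _
  · rw [localStabilizer_self, localStabilizer_of_ne hba.symm, hbm]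
    exact clockZ_pow_mul_shiftX_pow m t
  · intro v hv hva
    simp only [Finset.mem_filter, Finset.mem_univ, true_and, hva, false_or] at hv
    have hvb : v ≠ b := by rintro rfl; exact hcb hv.2
    rw [localStabilizer_of_ne hva, localStabilizer_of_ne hvb]
    exact (((Commute.refl (clockZ d)).pow_pow _ _).pow_right t).eq

/-- The constraint for a complete graph with three vertices `a`, `b`, `c`: quotients of two
stabilizers are supported on two vertices only. -/
theorem CQNModel.fidelityConstraint_of_complete (M : CQNModel N d) (l : M.Λ)
    (hN : N.IsBipartite) (hmult : ∀ i j, i ≠ j → G.mult i j = m)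
    (hψ : G.IsGraphState ψ) {a b c : V} (hab : a ≠ b) (hbc : b ≠ c) (hac : a ≠ c) (t : ℕ) :
    FidelityConstraint |Real.cos (t * m * Real.pi / d)| (pureFidelity ψ (M.state l)) := by
  have hu := fun i v k => pow_conjTranspose_mul_pow
    (localStabilizer_conjTranspose_mul_self (G := G) (d := d) i v) k
  have hc : ‖1 + clockRoot d ^ (m * t)‖ = 2 * |Real.cos (t * m * Real.pi / d)| := by
    rw [norm_one_add_clockRoot_pow]
    push_cast
    rw [mul_comm (m : ℝ)]
  have hZ : ∀ {i v : V}, v ≠ i → G.localStabilizer d i v = clockZ d ^ m := fun h => by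
    rw [localStabilizer_of_ne h, hmult _ _ h.symm]
  -- the factors of two stabilizers cancel away from their two vertices
  have hone : ∀ {i j v : V}, v ≠ i → v ≠ j →
      G.localStabilizer d i v ^ t * G.localStabilizer d j v ^ (t * (d - 1)) = 1 := by
    intro i j v hi hj
    rw [hZ hi, ← hZ hj]
    exact pow_mul_pow_mul_pred (localStabilizer_pow_self j v) t
  have hprod : ∀ i j, (tensorProd fun v =>
      G.localStabilizer d i v ^ t * G.localStabilizer d j v ^ (t * (d - 1))) =
      G.stabilizer d i ^ t * G.stabilizer d j ^ (t * (d - 1)) := by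
    intro i j
    rw [stabilizer_pow_eq, stabilizer_pow_eq, tensorProd_mul]
  have hpow : ∀ i j, (G.stabilizer d i ^ t * G.stabilizer d j ^ (t * (d - 1))) ^ d = 1 := by
    intro i j
    rw [((stabilizer_commute i j).pow_pow _ _).mul_pow, ← pow_mul, ← pow_mul, mul_comm t,
      mul_comm (t * _), pow_mul, pow_mul, stabilizer_pow_self, stabilizer_pow_self, one_pow,
      one_pow, one_mul]
  have hfix : ∀ i j, (G.stabilizer d i ^ t * G.stabilizer d j ^ (t * (d - 1))) *ᵥ ψ = ψ := by
    intro i j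
    rw [← mulVec_mulVec, pow_mulVec_eq (hψ.2 j), pow_mulVec_eq (hψ.2 i)]
  refine M.fidelityConstraint l hN hψ.1 (A := {a}) (C := {c})
    (p := fun v => G.localStabilizer d a v ^ t * G.localStabilizer d b v ^ (t * (d - 1)))
    (q := fun v => G.localStabilizer d b v ^ t * G.localStabilizer d c v ^ (t * (d - 1)))
    (r := fun v => G.localStabilizer d b v) (v₀ := a)
    (by simpa using hac) ?_ ?_ ?_ (fun v => mul_conjTranspose_mul_mul (hu _ _ _) (hu _ _ _))
    (fun v => mul_conjTranspose_mul_mul (hu _ _ _) (hu _ _ _))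
    (localStabilizer_conjTranspose_mul_self b)
    (by rw [hprod, hpow]) (by rw [hprod, hpow]) ?_ (by rw [hprod, hfix]) (by rw [hprod, hfix])
    (hψ.2 b) (by simp) ?_ ?_ hc
  · intro v hv
    rw [Finset.mem_singleton.mp hv]
    exact hone hac.symm hbc.symm
  · intro v hv
    rw [Finset.mem_singleton.mp hv]
    exact hone hab hac
  · intro v hva hvc
    rw [Finset.mem_singleton] at hva hvc
    by_cases hvb : v = b
    · subst hvb
      rw [Matrix.mul_assoc, ← Matrix.mul_assoc (_ ^ (t * (d - 1))), ← pow_add,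
        add_comm (t * (d - 1)), pow_add, pow_mul_pow_mul_pred (localStabilizer_pow_self v v),
        Matrix.one_mul]
      exact hone hva hvc
    · rw [hone hva hvb, hone hvb hvc, Matrix.one_mul]
  · rw [hprod, hprod]
    exact (((stabilizer_commute a b).pow_pow _ _).mul_right
      ((stabilizer_commute a c).pow_pow _ _)).mul_left
      (((stabilizer_commute b b).pow_pow _ _).mul_right ((stabilizer_commute b c).pow_pow _ _))
  · rw [localStabilizer_self, hZ hab, ← Matrix.mul_assoc, clockZ_pow_mul_shiftX_pow,
      smul_mul_assoc, Matrix.mul_assoc, Matrix.mul_assoc, ← pow_succ', ← pow_succ]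
  · intro v hv hva
    exact (hva (Finset.mem_singleton.mp hv)).elim

/-- A connected graph either is complete or contains an induced path on three vertices. -/
theorem CQNModel.fidelityConstraint_graphState (hV : 3 ≤ Fintype.card V) (M : CQNModel N d)
    (l : M.Λ) (hN : N.IsBipartite) (hconn : G.support.Connected)
    (hmult : ∀ i j, G.mult i j = m ∨ G.mult i j = 0) (hψ : G.IsGraphState ψ) (t : ℕ) :
    FidelityConstraint |Real.cos (t * m * Real.pi / d)| (pureFidelity ψ (M.state l)) := by
  by_cases hcomplete : ∀ i j, i ≠ j → G.support.Adj i j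
  · obtain ⟨a, b, c, hab, hac, hbc⟩ := Fintype.two_lt_card_iff.mp hV
    exact M.fidelityConstraint_of_complete l hN
      (fun i j hij => (hmult i j).resolve_right (hcomplete i j hij)) hψ hab hbc hac t
  · push Not at hcomplete
    obtain ⟨i, j, hij, hnadj⟩ := hcomplete
    obtain ⟨w, hw⟩ := (hconn i j).exists_walk_length_eq_dist
    have h1 : 1 < G.support.dist i j := by
      have h0 := hconn.pos_dist_of_ne hij
      have h1 : G.support.dist i j ≠ 1 := fun h => hnadj (SimpleGraph.dist_eq_one_iff_adj.mp h)
      omega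
    obtain ⟨a, b, c, hab, hbc, hac, hne⟩ := w.exists_adj_adj_not_adj_ne hw h1
    exact M.fidelityConstraint_of_induced_path l hN hmult hψ hab hbc.symm (not_not.mp hac) hne t

end GraphState

/-! ### Fidelity bounds for correlated networks -/

section Bounds

/-- Modulo one and up to sign, some multiple of `m / d` lies in `[1 / 3, 2 / 3]`. -/
theorem exists_abs_cos_le_half {m d : ℕ} (hm : 0 < m) (hmd : m < d) :
    ∃ t : ℕ, |Real.cos (t * m * Real.pi / d)| ≤ 1 / 2 := by
  have hd : (0 : ℝ) < d := by exact_mod_cast hm.trans hmd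
  have hm' : (0 : ℝ) < m := by exact_mod_cast hm
  have hmd' : (m : ℝ) < d := by exact_mod_cast hmd
  have hpi := Real.pi_pos
  have hmid : ∀ y : ℝ, 1 / 3 ≤ y → y ≤ 2 / 3 → |Real.cos (y * Real.pi)| ≤ 1 / 2 := by
    intro y h1 h2
    have h3 := Real.cos_le_cos_of_nonneg_of_le_pi (x := Real.pi / 3) (y := y * Real.pi)
      (by positivity) (by nlinarith) (by nlinarith)
    have h4 := Real.cos_le_cos_of_nonneg_of_le_pi (x := y * Real.pi) (y := Real.pi - Real.pi / 3)
      (by nlinarith) (by linarith) (by nlinarith)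
    rw [Real.cos_pi_sub, Real.cos_pi_div_three] at h4
    rw [Real.cos_pi_div_three] at h3
    exact abs_le.mpr ⟨h4, h3⟩
  have hsmall : ∀ y : ℝ, 0 < y → y ≤ 1 / 3 → ∃ t : ℕ, 1 / 3 ≤ t * y ∧ t * y ≤ 2 / 3 := by
    intro y hy hy3
    refine ⟨⌈1 / (3 * y)⌉₊, ?_, ?_⟩
    · have h := Nat.le_ceil (1 / (3 * y))
      rw [div_le_iff₀ (by positivity)] at h
      linarith
    · have h := Nat.ceil_lt_add_one (a := 1 / (3 * y)) (by positivity)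
      have h2 : 1 / (3 * y) * y = 1 / 3 := by field_simp
      nlinarith
  have hcos : ∀ t : ℕ, Real.cos (t * m * Real.pi / d) = Real.cos (t * (m / d) * Real.pi) :=
    fun t => by congr 1; ring
  have hx0 : (0 : ℝ) < m / d := by positivity
  have hx1 : (m : ℝ) / d < 1 := (div_lt_one hd).mpr hmd'
  simp only [hcos]
  generalize (m : ℝ) / d = x at hx0 hx1
  rcases le_total x (1 / 3) with h | h
  · obtain ⟨t, h1, h2⟩ := hsmall x hx0 h
    exact ⟨t, hmid _ h1 h2⟩
  rcases le_total x (2 / 3) with h' | h'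
  · exact ⟨1, hmid _ (by simpa using h) (by simpa using h')⟩
  · -- `x` is replaced by `1 - x`, which changes the cosine by a sign at most
    obtain ⟨t, h1, h2⟩ := hsmall (1 - x) (by linarith) (by linarith)
    refine ⟨t, ?_⟩
    rw [show t * x * Real.pi = t * Real.pi - t * (1 - x) * Real.pi by ring,
      Real.cos_nat_mul_pi_sub, abs_mul, abs_neg_one_pow, one_mul]
    exact hmid _ h1 h2

theorem sin_graphAngle (t m d : ℕ) :
    Real.sin (graphAngle t m d) = |Real.cos (t * m * Real.pi / d)| :=
  Real.sin_arcsin (by linarith [abs_nonneg (Real.cos (t * m * Real.pi / d))])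
    (Real.abs_cos_le_one _)

variable {V : Type*} [Fintype V] [DecidableEq V] {N : QNetwork V} {d : ℕ} [NeZero d]

/-- Shared randomness does not help: the fidelity is affine, so a bound that holds for each value
of the shared randomness holds for the mixture. -/
theorem pureFidelity_le_of_hasSum (M : CQNModel N d) {ψ : (V → ZMod d) → ℂ} {B : ℝ}
    {ρ : Matrix (V → ZMod d) (V → ZMod d) ℂ}
    (hρ : HasSum (fun l => (M.prob l : ℂ) • tensorChannel (M.channel l) M.jointSource) ρ)
    (hB : ∀ l, pureFidelity ψ (M.state l) ≤ B) : pureFidelity ψ ρ ≤ B := by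
  let φ : Matrix (V → ZMod d) (V → ZMod d) ℂ →+ ℝ :=
    { toFun := pureFidelity ψ
      map_zero' := by simp [pureFidelity]
      map_add' := fun A B => by simp [pureFidelity, add_mulVec] }
  have hφ : Continuous φ := by
    change Continuous fun A => (star ψ ⬝ᵥ (A *ᵥ ψ)).re
    fun_prop
  have h := hρ.map φ hφ
  have hl : ∀ l, φ ((M.prob l : ℂ) • tensorChannel (M.channel l) M.jointSource) =
      M.prob l * pureFidelity ψ (M.state l) := fun l => by
    change (star ψ ⬝ᵥ (((M.prob l : ℂ) • M.state l) *ᵥ ψ)).re = _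
    simp [pureFidelity, smul_mulVec]
  have h' := M.prob_sum.mul_right B
  rw [one_mul] at h'
  refine hasSum_le (fun l => ?_) h h'
  rw [Function.comp_apply, hl]
  exact mul_le_mul_of_nonneg_left (hB l) (M.prob_nonneg l)

theorem pureFidelity_ketBra {n : Type*} [Fintype n] {ψ : n → ℂ} (hψ : ∑ x, ‖ψ x‖ ^ 2 = 1) :
    pureFidelity ψ (ketBra ψ) = 1 := by
  rw [pureFidelity_eq, ketBra_mul_self hψ, ketBra, trace_vecMulVec, dotProduct_comm,
    star_dotProduct_self hψ, Complex.one_re]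

end Bounds

theorem mainTheorem1 {V : Type*} [Fintype V] [DecidableEq V] (hV : 3 ≤ Fintype.card V)
    (d : ℕ) [NeZero d] (m : ℕ) (hm0 : 0 < m) (hmd : m < d)
    (G : QMultigraph V) (hconn : G.support.Connected)
    (hmult : ∀ i j, G.mult i j = m ∨ G.mult i j = 0)
    (ψ : (V → ZMod d) → ℂ) (hψ : G.IsGraphState ψ) :
    -- the graph state cannot be prepared in any network with bipartite sources
    (∀ N : QNetwork V, N.IsBipartite → ¬ N.CanPrepare (ketBra ψ)) ∧
    -- a power `t` as required exists
    (∃ t : ℕ, |Real.cos (t * m * Real.pi / d)| ≤ 1 / 2) ∧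
    -- the fidelity bound for every such power, and its numerical size
    (∀ t : ℕ, |Real.cos (t * m * Real.pi / d)| ≤ 1 / 2 →
      (∀ N : QNetwork V, N.IsBipartite → ∀ ρ : Matrix (V → ZMod d) (V → ZMod d) ℂ,
        N.CanPrepare ρ →
          pureFidelity ψ ρ ≤ (7 + Real.sqrt (4 + 5 * Real.sin (graphAngle t m d))) / 10) ∧
      (7 + Real.sqrt (4 + 5 * Real.sin (graphAngle t m d))) / 10
        ≤ (7 + Real.sqrt (13 / 2)) / 10) ∧
    (7 + Real.sqrt (13 / 2)) / 10 < (0.95496 : ℝ) ∧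
    (∀ N : QNetwork V, N.IsBipartite → ∀ ρ : Matrix (V → ZMod d) (V → ZMod d) ℂ,
      N.CanPrepare ρ → pureFidelity ψ ρ < (0.95495 : ℝ)) := by
  have hfid : ∀ t : ℕ, ∀ N : QNetwork V, N.IsBipartite → ∀ M : CQNModel N d, ∀ l,
      FidelityConstraint |Real.cos (t * m * Real.pi / d)| (pureFidelity ψ (M.state l)) :=
    fun t N hN M l => M.fidelityConstraint_graphState hV l hN hconn hmult hψ t
  obtain ⟨t₀, ht₀⟩ := exists_abs_cos_le_half hm0 hmd
  have hstrict : ∀ N : QNetwork V, N.IsBipartite →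
      ∀ ρ : Matrix (V → ZMod d) (V → ZMod d) ℂ, N.CanPrepare ρ →
        pureFidelity ψ ρ < (0.95495 : ℝ) := by
    rintro N hN ρ ⟨M, hM⟩
    refine (pureFidelity_le_of_hasSum M hM fun l =>
      (hfid t₀ N hN M l).le_of_le_half ht₀).trans_lt (by norm_num)
  refine ⟨fun N hN hprep => ?_, ⟨t₀, ht₀⟩, fun t ht => ⟨?_, ?_⟩, ?_, hstrict⟩
  · have h := hstrict N hN _ hprep
    rw [pureFidelity_ketBra hψ.1] at h
    norm_num at h
  · rintro N hN ρ ⟨M, hM⟩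
    rw [sin_graphAngle]
    exact pureFidelity_le_of_hasSum M hM fun l => (hfid t N hN M l).le_sqrt (abs_nonneg _)
  · rw [sin_graphAngle]
    gcongr
    linarith
  · have h : Real.sqrt (13 / 2) < 2.5496 := by
      rw [Real.sqrt_lt' (by norm_num)]
      norm_num
    norm_num at h ⊢
    linarith
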